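/- **Setting.** Let $r\le d$. Write $\mathcal N(m,\Sigma)$ for the Gaussian law on $\mathbb R^d$. A law $\rho$ on $\mathbb R^d$ is *of the target form* with data $(\kappa,\pi,\mu,\Sigma)$ if $\rho=\int_{\mathbb R^\kappa}\mathcal N(\mu(c),\Sigma(c))\,d\pi(c)$ with $\pi$ a probability measure on $\mathbb R^\kappa$, $\mu:\mathbb R^\kappa\to\mathbb R^d$ and $\Sigma:\mathbb R^\kappa\to\mathbb R^{d\times d}$ measurable, and the $\Sigma(c)$ positive semidefinite and jointly diagonalizable. A *model* consists of: a locally Lipschitz activation $\sigma$ (applied entrywise), a bounded measurable time encoding $p$ on $[0,1]$, schedules $\alpha,\beta\in C^2([0,1])$, $\epsilon\in C^0([0,1])$ with $\alpha_0=\beta_1=1$, $\alpha_1=\beta_0=0$, $\alpha_t^2+\beta_t^2>0$, $\epsilon_t\ge 0$, a probability law on $[0,1]$ for the training times (with expectation $\mathbb E_t$), a learning rate $\eta>0$, a weight decay $\lambda\ge0$, and a sampling time $T\in[0,1]$ with $\alpha\ne0$ on $[0,T]$. For parameters $b\in\mathbb R$, $w\in\mathbb R^{d\times r}$, $v\in\mathbb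 R^r$ the denoiser is $$f_{b,w,v}(t,x)=b\,x+\tfrac{w}{\sqrt d}\,\sigma\Big(\tfrac{w^\top x}{\sqrt d}+p_tv\Big).$$ *Training* on a law $\rho$ with $n$ steps from a given initialization is online SGD: at each step, with a fresh pair $x_1\sim\rho$, $x_0\sim\mathcal N(0,I_d)$ and $L=\mathbb E_t\|x_1-f_{b,w,v}(t,\alpha_tx_0+\beta_tx_1)\|^2$, $$b\leftarrow b-\tfrac{\eta}{d^2}\partial_bL,\qquad w\leftarrow w-\eta\nabla_wL-\tfrac{\eta\lambda}{d}w,\qquad v\leftarrow v-\tfrac{\eta}{d}\nabla_vL-\tfrac{\eta\lambda}{d}v .$$ (Gradients are taken coordinatewise, and a partial derivative that does not exist is read as $0$.) With $\Gamma_t=\dot\beta_t-\frac{\dot\alpha_t}{\alpha_t}\beta_t+\epsilon_t\frac{\beta_t}{\alpha_t^2}$ and $\Delta_t=b\,\Gamma_t+\frac{\dot\alpha_t}{\alpha_t}-\frac{\epsilon_t}{\alpha_t^2}$, the law *generated* by parameters $(b,w,v)$ is the law of $X_T$, where $X$ is a solution on $[0,T]$ of $$dX_t=\Big[\Gamma_tf_{b,w,v}(t,X_t)+\Big(\tfrac{\dot\alpha_t}{\alpha_t}-\tfrac{\epsilon_t}{\alpha_t^2}\Big)X_t\Big]dt+\sqrt{2\epsilon_t}\,dW_t,\qquad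 X_0\sim\mathcal N(0,I_d),$$ with $W$ a $d$-dimensional Wiener process independent of $X_0$. *Retraining.* Let $\hat\rho_{(0)}$ be a fixed law of the target form (for some $\kappa$). For $g\ge 1$, the generation-$g$ model (its specification, initialization and number of steps may depend on $g$) is trained on pairs drawn i.i.d. from $\hat\rho_{(g-1)}\otimes\mathcal N(0,I_d)$ conditionally on all training data of earlier generations; call $b,w,v$ its trained parameters, and let $\hat\rho_{(g)}$ be the law it generates. **Statement (successive generated densities).** For every generation $g\ge1$ and every realization of the training data, $\hat\rho_{(g)}$ is again of the target form, with $\kappa=r$ and $\mu(c)=c$, as follows. Let $\mathcal W$ be the column space of $w$, and let $\Pi_{\mathcal W}$, $\Pi^\perp_{\mathcal W}$ be the orthogonal projections onto $\mathcal W$ and $\mathcal W^\perp$. There are matrices $U\in\mathbb R^{d\times r}$ with $UU^\top=\Pi_{\mathcal W}$ (if $w$ has rank $r$, these are exactly the matrices whose columns form an orthonormal basis of $\mathcal W$). For each such $U$, with $c\in\mathbb R^r$ identified with $Uc\in\mathcal W$: 1. $\hat\rho_{(g)}=\int_{\mathbb R^r}\mathcal N(Uc,\Sigma)\,d\pi(c)$,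 where $\pi$ is the law of $U^\top X$ for $X\sim\hat\rho_{(g)}$, i.e. the law of the projection onto $\mathcal W$, and the covariance is the same for all $c$: $$\Sigma=s\,\Pi_{\mathcal W}^\perp,\qquad s=e^{2\int_0^T\Delta_s ds}\Big[1+2\int_0^Te^{-2\int_0^s\Delta_hdh}\epsilon_s\,ds\Big],$$ with $\Delta$ evaluated at the trained skip connection $b$. 2. The centroids span a space of dimension at most $r$, and all but at most $r$ of the $d$ eigenvalues of $\Sigma$ (with multiplicity) equal $s$. 3. $\pi$ is the law of $G^\top Q^+Z_T$, where $Q=w^\top w/d$, $Q^+$ is its Moore–Penrose inverse, $G=w^\top U/\sqrt d$, and $Z$ solves the $r$-dimensional SDE $$dZ_t=\big[\Delta_tZ_t+\Gamma_tQ\,\sigma(Z_t+p_tv)\big]dt+\sqrt{2\epsilon_t}\,Q^{1/2}dB_t,\qquad Z_0\sim\mathcal N(0,Q),$$ with $B$ an $r$-dimensional Wiener process independent of $Z_0$. Thus the law on which generation $g+1$ is trained is again of the target form. -/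

import Mathlib

open MeasureTheory ProbabilityTheory Filter Topology Set
open scoped NNReal ENNReal Matrix MatrixOrder

universe u

/-! ### Generalized Gaussian mixtures -/

/-- `ρ` is the (possibly infinite) Gaussian mixture `∫ N(μ(c), Σ(c)) dπ(c)` over a latent space
of dimension `κ`, with jointly diagonalizable covariances. -/
structure IsGaussianMixture {d κ : ℕ} (ρ : Measure (EuclideanSpace ℝ (Fin d)))
    (π : Measure (EuclideanSpace ℝ (Fin κ)))
    (μ : EuclideanSpace ℝ (Fin κ) → EuclideanSpace ℝ (Fin d))
    (cov : EuclideanSpace ℝ (Fin κ) → Matrix (Fin d) (Fin d) ℝ) : Prop where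
  isProbabilityMeasure_weights : IsProbabilityMeasure π
  measurable_centroid : Measurable μ
  measurable_cov : ∀ i j, Measurable fun c => cov c i j
  posSemidef_cov : ∀ c, (cov c).PosSemidef
  jointly_diagonalizable : ∃ O ∈ Matrix.orthogonalGroup (Fin d) ℝ, ∀ c, (Oᵀ * cov c * O).IsDiag
  law_eq : ∀ A, MeasurableSet A → ρ A = ∫⁻ c, multivariateGaussian (μ c) (cov c) A ∂π

/-! ### The model: architecture, interpolation schedule and hyperparameters -/

/-- Dimension-free specification of one generative model: activation `σ`, time encoding `p`,
interpolation schedule `α`, `β`, diffusion schedule `ε`, law of the training times, learning rate,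
weight decay, and the sampling time `T` at which the generative SDE is stopped. -/
structure ModelSpec where
  σ : ℝ → ℝ
  p : ℝ → ℝ
  α : ℝ → ℝ
  β : ℝ → ℝ
  ε : ℝ → ℝ
  timeLaw : Measure ℝ
  learningRate : ℝ
  weightDecay : ℝ
  T : ℝ
  locallyLipschitz_σ : LocallyLipschitz σ
  measurable_p : Measurable p
  bounded_p : ∃ C, ∀ t ∈ Icc (0 : ℝ) 1, |p t| ≤ C
  contDiffOn_α : ContDiffOn ℝ 2 α (Icc 0 1)
  contDiffOn_β : ContDiffOn ℝ 2 β (Icc 0 1)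
  continuousOn_ε : ContinuousOn ε (Icc 0 1)
  α_zero : α 0 = 1
  α_one : α 1 = 0
  β_zero : β 0 = 0
  β_one : β 1 = 1
  α_sq_add_β_sq_pos : ∀ t ∈ Icc (0 : ℝ) 1, 0 < α t ^ 2 + β t ^ 2
  ε_nonneg : ∀ t ∈ Icc (0 : ℝ) 1, 0 ≤ ε t
  isProbabilityMeasure_timeLaw : IsProbabilityMeasure timeLaw
  timeLaw_compl : timeLaw (Icc 0 1)ᶜ = 0
  learningRate_pos : 0 < learningRate
  weightDecay_nonneg : 0 ≤ weightDecay
  T_mem : T ∈ Icc (0 : ℝ) 1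
  α_ne_zero : ∀ t ∈ Icc (0 : ℝ) T, α t ≠ 0

/-- Trainable parameters: skip connection `b`, tied weights `w`, time-encoding weights `v`. -/
structure Params (d r : ℕ) where
  b : ℝ
  w : Matrix (Fin d) (Fin r) ℝ
  v : Fin r → ℝ

noncomputable section

namespace ModelSpec

variable {d r : ℕ}

/-- The denoiser `f(t, x) = b x + (w / √d) σ(wᵀ x / √d + p_t v)`. -/
def dae (S : ModelSpec) (θ : Params d r) (t : ℝ) (x : EuclideanSpace ℝ (Fin d)) :
    EuclideanSpace ℝ (Fin d) :=
  θ.b • x + WithLp.toLp 2 ((1 / √(d : ℝ)) •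
    (θ.w *ᵥ fun γ => S.σ ((θ.wᵀ *ᵥ x.ofLp) γ / √(d : ℝ) + S.p t * θ.v γ)))

/-- The loss `𝔼_t ‖x₁ - f(t, α_t x₀ + β_t x₁)‖²` of the pair `z = (x₁, x₀)`. -/
def loss (S : ModelSpec) (z : EuclideanSpace ℝ (Fin d) × EuclideanSpace ℝ (Fin d))
    (θ : Params d r) : ℝ :=
  ∫ t, ‖z.1 - S.dae θ t (S.α t • z.2 + S.β t • z.1)‖ ^ 2 ∂S.timeLaw

/-- One step of online SGD on the pair `z = (x₁, x₀)`; gradients are taken coordinatewise. -/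
def sgdStep (S : ModelSpec) (z : EuclideanSpace ℝ (Fin d) × EuclideanSpace ℝ (Fin d))
    (θ : Params d r) : Params d r where
  b := θ.b - S.learningRate / (d : ℝ) ^ 2 * deriv (fun h => S.loss z ⟨θ.b + h, θ.w, θ.v⟩) 0
  w := θ.w
    - S.learningRate •
        (Matrix.of fun i γ => deriv (fun h => S.loss z ⟨θ.b, θ.w + Matrix.single i γ h, θ.v⟩) 0)
    - (S.learningRate * S.weightDecay / d) • θ.w
  v := θ.v
    - (S.learningRate / d) • (fun γ => deriv (fun h => S.loss z ⟨θ.b, θ.w, θ.v + Pi.single γ h⟩) 0)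
    - (S.learningRate * S.weightDecay / d) • θ.v

/-- Parameters after `n` steps of online SGD along the stream of pairs `z`. -/
def sgd (S : ModelSpec) (z : ℕ → EuclideanSpace ℝ (Fin d) × EuclideanSpace ℝ (Fin d))
    (θ₀ : Params d r) : ℕ → Params d r
  | 0 => θ₀
  | n + 1 => S.sgdStep (z n) (S.sgd z θ₀ n)

/-- `Γ_t = β'_t - (α'_t / α_t) β_t + ε_t β_t / α_t²`. -/
def Gam (S : ModelSpec) (t : ℝ) : ℝ :=
  derivWithin S.β (Icc 0 1) t - derivWithin S.α (Icc 0 1) t / S.α t * S.β t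
    + S.ε t * (S.β t / S.α t ^ 2)

/-- `Δ_t = b Γ_t + α'_t / α_t - ε_t / α_t²`. -/
def Del (S : ModelSpec) (b t : ℝ) : ℝ :=
  b * S.Gam t + derivWithin S.α (Icc 0 1) t / S.α t - S.ε t / S.α t ^ 2

/-- Drift of the generative SDE in which the denoiser replaces the true denoising function. -/
def drift (S : ModelSpec) (θ : Params d r) (t : ℝ) (x : EuclideanSpace ℝ (Fin d)) :
    EuclideanSpace ℝ (Fin d) :=
  S.Gam t • S.dae θ t x + (derivWithin S.α (Icc 0 1) t / S.α t - S.ε t / S.α t ^ 2) • x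

/-- The scalar variance `e^{2∫₀ᵗ Δ_s ds} [1 + 2 ∫₀ᵗ e^{-2∫₀ˢ Δ_h dh} ε_s ds]`. -/
def variance (S : ModelSpec) (b t : ℝ) : ℝ :=
  Real.exp (2 * ∫ s in (0 : ℝ)..t, S.Del b s) *
    (1 + 2 * ∫ s in (0 : ℝ)..t, Real.exp (-2 * ∫ h in (0 : ℝ)..s, S.Del b h) * S.ε s)

end ModelSpec

namespace Params

variable {d r : ℕ}

/-- The column space of the weight matrix. -/
def weightSpace (θ : Params d r) : Submodule ℝ (EuclideanSpace ℝ (Fin d)) :=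
  Submodule.span ℝ (range fun γ : Fin r => WithLp.toLp 2 (θ.w.col γ))

/-- Matrix of the orthogonal projection onto the weight column space. -/
def proj (θ : Params d r) : Matrix (Fin d) (Fin d) ℝ :=
  (Matrix.toEuclideanCLM (n := Fin d) (𝕜 := ℝ)).symm θ.weightSpace.starProjection

/-- Matrix of the orthogonal projection onto the orthogonal complement of the weight column
space. -/
def projPerp (θ : Params d r) : Matrix (Fin d) (Fin d) ℝ :=
  (Matrix.toEuclideanCLM (n := Fin d) (𝕜 := ℝ)).symm θ.weightSpaceᗮ.starProjection

/-- The overlap matrix `wᵀ w / d`. -/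
def overlap (θ : Params d r) : Matrix (Fin r) (Fin r) ℝ := (1 / (d : ℝ)) • (θ.wᵀ * θ.w)

end Params

/-! ### Stochastic differential equations with additive noise -/

/-- A standard `m`-dimensional Wiener process. -/
structure IsWiener {Ω : Type u} [MeasurableSpace Ω] {m : ℕ} (P : Measure Ω)
    (B : Fin m → ℝ≥0 → Ω → ℝ) : Prop where
  measurable : ∀ i s, Measurable (B i s)
  isBrownian : ∀ i, IsBrownianReal (B i) P
  indep : iIndepFun (fun i ω s => B i s ω) P

/-- The Riemann sum, over the uniform partition of `[0, t]` into `n` pieces, of the Wiener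
integral `∫₀ᵗ h_s dB_s`. -/
def wienerSum {Ω : Type u} {m : ℕ} (h : ℝ → ℝ) (B : Fin m → ℝ≥0 → Ω → ℝ) (t : ℝ) (n : ℕ)
    (ω : Ω) : Fin m → ℝ := fun i =>
  ∑ k ∈ Finset.range n, h (k / n * t) *
    (B i ((k + 1) / n * t.toNNReal) ω - B i (k / n * t.toNNReal) ω)

/-- On `[0, T]` the continuous process `X` solves `dX_t = F(t, X_t) dt + h_t A dB_t` with initial
value independent of the Wiener process `B`. Here `h` is deterministic and continuous, and the
stochastic integral is the limit in probability of its Riemann sums. -/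
structure IsSDESolution {Ω : Type u} [MeasurableSpace Ω] {k m : ℕ} (P : Measure Ω)
    (B : Fin m → ℝ≥0 → Ω → ℝ)
    (F : ℝ → EuclideanSpace ℝ (Fin k) → EuclideanSpace ℝ (Fin k)) (h : ℝ → ℝ)
    (A : Matrix (Fin k) (Fin m) ℝ) (T : ℝ) (X : ℝ → Ω → EuclideanSpace ℝ (Fin k)) : Prop where
  isWiener : IsWiener P B
  measurable : ∀ t ∈ Icc 0 T, Measurable (X t)
  indep : IndepFun (X 0) (fun ω i s => B i s ω) P
  continuousOn : ∀ᵐ ω ∂P, ContinuousOn (fun t => X t ω) (Icc 0 T)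
  integrable : ∀ᵐ ω ∂P, IntervalIntegrable (fun t => F t (X t ω)) volume 0 T
  integral_eq : ∀ t ∈ Icc 0 T,
    TendstoInMeasure P (fun n ω => WithLp.toLp 2 (A *ᵥ wienerSum h B t n ω)) atTop
      (fun ω => X t ω - X 0 ω - ∫ s in (0 : ℝ)..t, F s (X s ω))

/-- `ρ` is the density generated by the model with parameters `θ`: the law at time `T` of a
solution of the generative SDE started from a standard Gaussian vector. -/
def IsGeneratedBy {d r : ℕ} (S : ModelSpec) (θ : Params d r)
    (ρ : Measure (EuclideanSpace ℝ (Fin d))) : Prop :=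
  ∃ (Ω : Type u) (_ : MeasurableSpace Ω) (P : Measure Ω) (_ : IsProbabilityMeasure P)
    (B : Fin d → ℝ≥0 → Ω → ℝ) (X : ℝ → Ω → EuclideanSpace ℝ (Fin d)),
    P.map (X 0) = stdGaussian (EuclideanSpace ℝ (Fin d)) ∧
    IsSDESolution P B (S.drift θ) (fun t => √(2 * S.ε t)) 1 S.T X ∧
    ρ = P.map (X S.T)

/-- `ν` is the law at time `T` of a solution `Z` of the low-dimensional SDE
`dZ_t = (Δ_t Z_t + Γ_t Q σ(Z_t + p_t v)) dt + √(2 ε_t) Q^{1/2} dB_t`, `Z_0 ∼ N(0, Q)`,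
with `Q = wᵀ w / d`. -/
def IsReducedLaw {d r : ℕ} (S : ModelSpec) (θ : Params d r)
    (ν : Measure (EuclideanSpace ℝ (Fin r))) : Prop :=
  ∃ (Ω : Type u) (_ : MeasurableSpace Ω) (P : Measure Ω) (_ : IsProbabilityMeasure P)
    (B : Fin r → ℝ≥0 → Ω → ℝ) (Z : ℝ → Ω → EuclideanSpace ℝ (Fin r)),
    P.map (Z 0) = multivariateGaussian 0 θ.overlap ∧
    IsSDESolution P B
      (fun t z => S.Del θ.b t • z + S.Gam t •
        WithLp.toLp 2 (θ.overlap *ᵥ fun γ => S.σ (z γ + S.p t * θ.v γ)))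
      (fun t => √(2 * S.ε t)) (CFC.sqrt θ.overlap) S.T Z ∧
    ν = P.map (Z S.T)

/-- `N` is the Moore-Penrose pseudo-inverse of the real matrix `M`. -/
structure IsMoorePenrose {m n : ℕ} (M : Matrix (Fin m) (Fin n) ℝ)
    (N : Matrix (Fin n) (Fin m) ℝ) : Prop where
  mul_mul_self : M * N * M = M
  mul_mul_inv : N * M * N = N
  symm_left : (M * N)ᵀ = M * N
  symm_right : (N * M)ᵀ = N * M

/-! ### Successive generations -/

/-- A chain of successive retrainings on synthetic data. The density `ρ g` is that of generation
`g`, generation `0` being the original target. The next model starts from the initialization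
`θ₀ g` and is trained by `n g` steps of online SGD on fresh pairs `(x₁, x₀)`, drawn i.i.d. from
`ρ g ⊗ N(0, I)` conditionally on all earlier generations; `θ g` are the trained parameters, and
`ρ (g + 1)` is the density which this trained model generates. The densities are random through
the training data. -/
structure IsRetrainingChain {d r : ℕ} {Ω : Type*} [MeasurableSpace Ω] (P : Measure Ω)
    (S : ℕ → ModelSpec) (θ₀ : ℕ → Params d r) (n : ℕ → ℕ)
    (z : ℕ → ℕ → Ω → EuclideanSpace ℝ (Fin d) × EuclideanSpace ℝ (Fin d))
    (θ : ℕ → Ω → Params d r) (ρ : ℕ → Ω → Measure (EuclideanSpace ℝ (Fin d))) : Prop where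
  measurable_sample : ∀ g k, Measurable (z g k)
  measurable_density : ∀ g, Measurable (ρ g)
  sample_law : ∀ g N,
    ∀ H : Set (Fin g → ℕ → EuclideanSpace ℝ (Fin d) × EuclideanSpace ℝ (Fin d)), MeasurableSet H →
    ∀ A : Set (Fin N → EuclideanSpace ℝ (Fin d) × EuclideanSpace ℝ (Fin d)), MeasurableSet A →
      P {ω | (fun (j : Fin g) k => z j k ω) ∈ H ∧ (fun k : Fin N => z g k ω) ∈ A} =
        ∫⁻ ω in {ω | (fun (j : Fin g) k => z j k ω) ∈ H},
          Measure.pi (fun _ : Fin N =>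
            (ρ g ω).prod (stdGaussian (EuclideanSpace ℝ (Fin d)))) A ∂P
  trained : ∀ g ω, θ g ω = (S g).sgd (fun k => z g k ω) (θ₀ g) (n g)
  generated : ∀ g ω, IsGeneratedBy.{u} (S g) (θ g ω) (ρ (g + 1) ω)

end

/-! Fix a generation and a realization, so that the parameters are constants, and put `M = w / √d`,
`Q = Mᵀ M`. The nonlinear part of the drift takes values in the column space `𝒲` and sees `x` only
through `Mᵀ x` (`euclideanMap_drift`). Hence two linear images of the solution satisfy closed
equations: `Z = Mᵀ X` solves the low-dimensional equation with noise `Mᵀ dB`, and `Y = Π⊥ X` solves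
the linear equation `dY = Δ Y dt + √(2ε) Π⊥ dB`. Because `Mᵀ Π⊥ = 0`, the initial values and noises
of the two equations are uncorrelated, hence independent, being jointly Gaussian. If `Z_T` and `Y_T`
are functionals of their own noise, they are independent too. Moreover `Uᵀ X_T` is a linear image of
`Z_T`, since `Uᵀ = Gᵀ Q⁺ Mᵀ`, and `X_T = U (Uᵀ X_T) + Y_T`. By Fubini `X_T` is a mixture of
translates of the law of `Y_T`, which is `N(0, s Π⊥)`.

Two points need work, and both are treated pathwise, without Itô calculus. The first is that a
solution is a functional of its initial value and noise (`aestronglyMeasurable_of_additive_noise`).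
The noise is additive, so the path `N_t = X_t - X_0 - ∫₀ᵗ F` is a limit in probability of Riemann
sums and is measurable for the noise `σ`-algebra. The Euler scheme driven by `N` is a measurable
function of these data and converges to `X_T` along every continuous solution path
(`tendsto_eulerScheme`). Local Lipschitz continuity suffices, because the path is bounded.

The second is the law of `Y_T` (`map_eq_gaussianReal_of_linear`). Summation by parts gives `φ_T y_T`
as the limit of `y_0 + ∑ φ_k (N_{k+1} - N_k)`, with `φ` the integrating factor. Each `N_k` is itself
a limit of sums of Brownian increments, so two successive limits of centered Gaussian variables with
explicit variances yield the formula for `s`.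

For the low-dimensional equation, `Mᵀ B` must be written as `Q^{1/2}` times an `r`-dimensional
Wiener process. The polar decomposition `Mᵀ = Q^{1/2} V` with `V Vᵀ = 1` provides the process `V B`;
this is where `r ≤ d` enters (`exists_polar`). The eigenvalue count compares the characteristic
polynomials of `U Uᵀ` and `Uᵀ U`. -/

/-! ### The joint Gaussian field of an initial value and a Wiener process -/

section NoiseField

variable {Ω : Type u} [MeasurableSpace Ω] {P : Measure Ω} {d r : ℕ}

/-- All linear functionals of the initial value `X₀` and of the Wiener process `B`, evaluated at
all times. -/
noncomputable def noiseField (X₀ : Ω → EuclideanSpace ℝ (Fin d)) (B : Fin d → ℝ≥0 → Ω → ℝ) :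
    EuclideanSpace ℝ (Fin d) ⊕ EuclideanSpace ℝ (Fin d) × ℝ≥0 → Ω → ℝ
  | .inl η, ω => ∑ i, η i * X₀ ω i
  | .inr (η, s), ω => ∑ i, η i * B i s ω

/-- A standard Gaussian initial value which is independent of a standard Wiener process. -/
structure IsGaussianNoise (P : Measure Ω) (X₀ : Ω → EuclideanSpace ℝ (Fin d))
    (B : Fin d → ℝ≥0 → Ω → ℝ) : Prop where
  measurable : Measurable X₀
  map_eq : P.map X₀ = stdGaussian (EuclideanSpace ℝ (Fin d))
  isWiener : IsWiener P B
  indep : IndepFun X₀ (fun ω i s => B i s ω) P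

/-- Covariance of the noise field. -/
noncomputable def noiseCov :
    EuclideanSpace ℝ (Fin d) ⊕ EuclideanSpace ℝ (Fin d) × ℝ≥0 →
    EuclideanSpace ℝ (Fin d) ⊕ EuclideanSpace ℝ (Fin d) × ℝ≥0 → ℝ
  | .inl η, .inl η' => ∑ i, η i * η' i
  | .inr (η, s), .inr (η', t) => (∑ i, η i * η' i) * (min s t : ℝ≥0)
  | _, _ => 0

namespace IsGaussianNoise

variable {X₀ : Ω → EuclideanSpace ℝ (Fin d)} {B : Fin d → ℝ≥0 → Ω → ℝ}

/-- Independent Gaussian vectors are jointly Gaussian. This is applied first across the coordinates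
of `B`, then to `X₀` and `B`. -/
lemma hasGaussianLaw_coords (h : IsGaussianNoise P X₀ B) (I : Finset ℝ≥0) :
    HasGaussianLaw (fun ω => (X₀ ω, fun (i : Fin d) (s : I) => B i s ω)) P := by
  have hX : HasGaussianLaw X₀ P := ⟨by rw [h.map_eq]; infer_instance⟩
  have hP := hX.isProbabilityMeasure
  have hB : HasGaussianLaw (fun ω (i : Fin d) (s : I) => B i s ω) P := by
    apply iIndepFun.hasGaussianLaw (X := fun (i : Fin d) ω (s : I) => B i s ω)
    · intro i
      exact ((h.isWiener.isBrownian i).hasLaw I).hasGaussianLaw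
    · exact h.isWiener.indep.comp (fun _ (b : ℝ≥0 → ℝ) (s : I) => b s) (fun _ => by fun_prop)
  refine IndepFun.hasGaussianLaw hX hB ?_
  exact h.indep.comp (φ := id) (ψ := fun b i (s : I) => b i s) measurable_id (by fun_prop)

/-- Finitely many members of the field involve only a finite set `J` of times, so they form a linear
image of the Gaussian vector of `hasGaussianLaw_coords`. -/
lemma isGaussian_noiseField (h : IsGaussianNoise P X₀ B) :
    IsGaussianProcess (noiseField X₀ B) P := by
  classical
  refine ⟨fun I => ?_⟩
  let J : Finset ℝ≥0 := I.biUnion fun p => Sum.elim (fun _ => ∅) (fun q => {q.2}) p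
  have hJ : ∀ p : I, ∀ η s, p.1 = Sum.inr (η, s) → s ∈ J := fun p η s hp =>
    Finset.mem_biUnion.2 ⟨p.1, p.2, by simp [hp]⟩
  let L : (EuclideanSpace ℝ (Fin d) × (Fin d → J → ℝ)) →ₗ[ℝ] (I → ℝ) :=
    { toFun x p := match hp : p.1 with
        | .inl η => ∑ i, η i * x.1 i
        | .inr (η, s) => ∑ i, η i * x.2 i ⟨s, hJ p η s hp⟩
      map_add' x y := by
        ext p
        simp only [Pi.add_apply]
        split <;> simp [mul_add, Finset.sum_add_distrib]
      map_smul' c x := by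
        ext p
        simp only [Pi.smul_apply, RingHom.id_apply]
        split <;> simp [Finset.mul_sum, mul_left_comm] }
  convert! (h.hasGaussianLaw_coords J).map_fun L.toContinuousLinearMap with ω
  ext p
  simp only [Finset.restrict, LinearMap.coe_toContinuousLinearMap', L, LinearMap.coe_mk,
    AddHom.coe_mk]
  split <;> rename_i hp <;> rw [hp] <;> rfl

lemma isProbabilityMeasure (h : IsGaussianNoise P X₀ B) : IsProbabilityMeasure P :=
  h.isGaussian_noiseField.isProbabilityMeasure

lemma measurable_noiseField (h : IsGaussianNoise P X₀ B) (p) : Measurable (noiseField X₀ B p) := by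
  have h1 := h.measurable
  have h2 := h.isWiener.measurable
  rcases p with η | ⟨η, s⟩
  · exact Finset.measurable_sum _ fun i _ => (by fun_prop : Measurable fun ω => X₀ ω i).const_mul _
  · exact Finset.measurable_sum _ fun i _ => (h2 i s).const_mul _

lemma memLp_coord (h : IsGaussianNoise P X₀ B) (i : Fin d) : MemLp (fun ω => X₀ ω i) 2 P :=
  ((h.hasGaussianLaw_coords ∅).fst.map_fun (EuclideanSpace.proj i)).memLp_two

lemma memLp_wiener (h : IsGaussianNoise P X₀ B) (i : Fin d) (s : ℝ≥0) : MemLp (B i s) 2 P :=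
  ((h.isWiener.isBrownian i).hasLaw_eval s).hasGaussianLaw.memLp_two

lemma integral_coord (h : IsGaussianNoise P X₀ B) (i : Fin d) : ∫ ω, X₀ ω i ∂P = 0 := by
  have := integral_map (μ := P) (φ := X₀) h.measurable.aemeasurable
    (f := fun x : EuclideanSpace ℝ (Fin d) => EuclideanSpace.proj (𝕜 := ℝ) i x)
    (by fun_prop)
  rw [h.map_eq, integral_strongDual_stdGaussian] at this
  exact this.symm

lemma integral_noiseField (h : IsGaussianNoise P X₀ B) (p) : ∫ ω, noiseField X₀ B p ω ∂P = 0 := by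
  have := h.isProbabilityMeasure
  rcases p with η | ⟨η, s⟩
  · simp only [noiseField]
    rw [integral_finsetSum _ fun i _ => ((h.memLp_coord i).integrable (by norm_num)).const_mul _]
    simp [integral_const_mul, h.integral_coord]
  · simp only [noiseField]
    rw [integral_finsetSum _ fun i _ => ((h.memLp_wiener i s).integrable (by norm_num)).const_mul _]
    refine Finset.sum_eq_zero fun i _ => ?_
    rw [integral_const_mul]
    have := (h.isWiener.isBrownian i).integral_eval s
    simp [this]

lemma covariance_coord (h : IsGaussianNoise P X₀ B) (i j : Fin d) :
    cov[fun ω => X₀ ω i, fun ω => X₀ ω j; P] = if i = j then 1 else 0 := by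
  rw [← covariance_map_fun (Z := X₀) (X := fun x : EuclideanSpace ℝ (Fin d) => x i)
    (Y := fun x : EuclideanSpace ℝ (Fin d) => x j) (by fun_prop) (by fun_prop)
    h.measurable.aemeasurable, h.map_eq, ← multivariateGaussian_zero_one,
    covariance_eval_multivariateGaussian Matrix.PosSemidef.one, Matrix.one_apply]

lemma covariance_wiener (h : IsGaussianNoise P X₀ B) (i j : Fin d) (s t : ℝ≥0) :
    cov[B i s, B j t; P] = if i = j then ((min s t : ℝ≥0) : ℝ) else 0 := by
  split_ifs with hij
  · subst hij
    exact (h.isWiener.isBrownian i).covariance_eval s t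
  · have hs : ∀ s, Measurable fun b : ℝ≥0 → ℝ => b s := fun s => measurable_pi_apply s
    have := (h.isWiener.indep.indepFun hij).comp (hs s) (hs t)
    exact this.covariance_eq_zero (h.memLp_wiener i s) (h.memLp_wiener j t)

lemma covariance_coord_wiener (h : IsGaussianNoise P X₀ B) (i j : Fin d) (t : ℝ≥0) :
    cov[fun ω => X₀ ω i, B j t; P] = 0 := by
  have := h.indep.comp (φ := fun x => x i) (ψ := fun b => b j t) (by fun_prop) (by fun_prop)
  exact this.covariance_eq_zero (h.memLp_coord i) (h.memLp_wiener j t)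

lemma covariance_noiseField (h : IsGaussianNoise P X₀ B) (p q) :
    cov[noiseField X₀ B p, noiseField X₀ B q; P] = noiseCov p q := by
  have := h.isProbabilityMeasure
  have h1 := h.memLp_coord
  have h2 := h.memLp_wiener
  have h3 : ∀ (η : EuclideanSpace ℝ (Fin d)) i, MemLp (fun ω => η i * X₀ ω i) 2 P :=
    fun η i => (h1 i).const_mul _
  have h4 : ∀ (η : EuclideanSpace ℝ (Fin d)) s i, MemLp (fun ω => η i * B i s ω) 2 P :=
    fun η s i => (h2 i s).const_mul _
  have h5 : ∀ (η η' : EuclideanSpace ℝ (Fin d)) t,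
      cov[noiseField X₀ B (.inl η), noiseField X₀ B (.inr (η', t)); P] = 0 := by
    intro η η' t
    rw [show noiseField X₀ B (.inl η) = fun ω => ∑ i, η i * X₀ ω i from rfl,
      show noiseField X₀ B (.inr (η', t)) = fun ω => ∑ i, η' i * B i t ω from rfl,
      covariance_fun_sum_fun_sum (h3 η) (h4 η' t)]
    refine Finset.sum_eq_zero fun i _ => Finset.sum_eq_zero fun j _ => ?_
    rw [covariance_const_mul_left, covariance_const_mul_right]
    have := h.covariance_coord_wiener i j t
    simp [this]
  rcases p with η | ⟨η, s⟩ <;> rcases q with η' | ⟨η', t⟩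
  · rw [show noiseField X₀ B (.inl η) = fun ω => ∑ i, η i * X₀ ω i from rfl,
      show noiseField X₀ B (.inl η') = fun ω => ∑ i, η' i * X₀ ω i from rfl,
      covariance_fun_sum_fun_sum (h3 η) (h3 η')]
    simp [covariance_const_mul_left, covariance_const_mul_right, h.covariance_coord, noiseCov,
      mul_comm]
  · exact h5 η η' t
  · rw [covariance_comm]
    exact h5 η' η s
  · rw [show noiseField X₀ B (.inr (η, s)) = fun ω => ∑ i, η i * B i s ω from rfl,
      show noiseField X₀ B (.inr (η', t)) = fun ω => ∑ i, η' i * B i t ω from rfl,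
      covariance_fun_sum_fun_sum (h4 η s) (h4 η' t)]
    have h6 : ∀ i j, cov[fun ω => B i s ω, fun ω => B j t ω; P] =
      if i = j then ((min s t : ℝ≥0) : ℝ) else 0 := fun i j => h.covariance_wiener i j s t
    simp [covariance_const_mul_left, covariance_const_mul_right, h6, noiseCov, Finset.sum_mul,
      mul_assoc, mul_left_comm]

/-- Two uncorrelated families of members of the noise field are independent. -/
lemma indepFun_noiseField (h : IsGaussianNoise P X₀ B) {S T : Type*}
    (f : S → EuclideanSpace ℝ (Fin d) ⊕ EuclideanSpace ℝ (Fin d) × ℝ≥0)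
    (g : T → EuclideanSpace ℝ (Fin d) ⊕ EuclideanSpace ℝ (Fin d) × ℝ≥0)
    (hfg : ∀ s t, noiseCov (f s) (g t) = 0) :
    IndepFun (fun ω s => noiseField X₀ B (f s) ω) (fun ω t => noiseField X₀ B (g t) ω) P := by
  apply IsGaussianProcess.indepFun_of_covariance_eq_zero (X := fun s => noiseField X₀ B (f s))
    (Y := fun s => noiseField X₀ B (g s))
  · convert! h.isGaussian_noiseField.comp_right (Sum.elim f g) using 1
    ext p ω
    rcases p with s | t <;> rfl
  · exact fun s => (h.measurable_noiseField _).aemeasurable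
  · exact fun s => (h.measurable_noiseField _).aemeasurable
  · intro s t
    rw [h.covariance_noiseField, hfg]

end IsGaussianNoise

/-- A co-isometric image of a Wiener process is a Wiener process. -/
lemma IsGaussianNoise.isWiener_mulVec {X₀ : Ω → EuclideanSpace ℝ (Fin d)}
    {B : Fin d → ℝ≥0 → Ω → ℝ} (h : IsGaussianNoise P X₀ B) (V : Matrix (Fin r) (Fin d) ℝ)
    (hV : V * Vᵀ = 1) : IsWiener P (fun γ s ω => (V *ᵥ fun i => B i s ω) γ) := by
  -- The rows of `V` are orthonormal. For Gaussian processes this covariance alone yields both the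
  -- Brownian law of each coordinate and their independence.
  have hcov : ∀ γ γ' (s t : ℝ≥0), noiseCov (.inr (WithLp.toLp 2 (V γ), s))
      (.inr (WithLp.toLp 2 (V γ'), t)) = if γ = γ' then ((min s t : ℝ≥0) : ℝ) else 0 := by
    intro γ γ' s t
    have := congr_fun (congr_fun hV γ) γ'
    simp only [Matrix.mul_apply, Matrix.transpose_apply, Matrix.one_apply] at this
    simp [noiseCov, this]
  have heq : ∀ γ s, (fun ω => (V *ᵥ fun i => B i s ω) γ) =
    noiseField X₀ B (.inr (WithLp.toLp 2 (V γ), s)) := fun γ s => rfl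
  refine ⟨fun γ s => ?_, fun γ => ⟨?_, ?_⟩, ?_⟩
  · exact h.measurable_noiseField (.inr (WithLp.toLp 2 (V γ), s))
  · refine IsGaussianProcess.isPreBrownianReal_of_covariance ?_ ?_ ?_
    · exact h.isGaussian_noiseField.comp_right fun s => .inr (WithLp.toLp 2 (V γ), s)
    · exact fun s => h.integral_noiseField (.inr (WithLp.toLp 2 (V γ), s))
    · intro s t hst
      rw [heq, heq, h.covariance_noiseField, hcov]
      simp [hst]
  · filter_upwards [ae_all_iff.2 fun i => (h.isWiener.isBrownian i).cont] with ω hω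
    simp only [Matrix.mulVec, dotProduct]
    fun_prop
  · apply IsGaussianProcess.iIndepFun_of_covariance_eq_zero
      (X := fun γ s => noiseField X₀ B (.inr (WithLp.toLp 2 (V γ), s)))
    · exact h.isGaussian_noiseField.comp_right
        fun p : (_ : Fin r) × ℝ≥0 => .inr (WithLp.toLp 2 (V p.1), p.2)
    · exact fun γ s => (h.measurable_noiseField _).aemeasurable
    · intro γ γ' hγ s t
      rw [h.covariance_noiseField, hcov, if_neg hγ]

/-- Law of the initial value plus a Wiener integral of a step function, in one direction. -/
lemma IsGaussianNoise.map_add_sum_increments {X₀ : Ω → EuclideanSpace ℝ (Fin d)}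
    {B : Fin d → ℝ≥0 → Ω → ℝ} (h : IsGaussianNoise P X₀ B) (η : EuclideanSpace ℝ (Fin d)) (n : ℕ)
    (c : ℕ → ℝ) (t : ℕ → ℝ≥0) (ht : Monotone t) :
    P.map (fun ω => noiseField X₀ B (.inl η) ω + ∑ i ∈ Finset.range n,
      c i * (noiseField X₀ B (.inr (η, t (i + 1))) ω - noiseField X₀ B (.inr (η, t i)) ω)) =
    gaussianReal 0 ((∑ i, η i * η i) *
      (1 + ∑ i ∈ Finset.range n, c i ^ 2 * (t (i + 1) - t i : ℝ))).toNNReal := by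
  have hP := h.isProbabilityMeasure
  set q : ℝ := ∑ i, η i * η i with hq
  set N := noiseField X₀ B with hN
  have hmem : ∀ p, MemLp (N p) 2 P := fun p =>
    (h.isGaussian_noiseField.hasGaussianLaw_eval p).memLp_two
  -- The index `none` carries the initial value and `some i` the weighted increment over cell `i`.
  -- These are pairwise uncorrelated, so their variances add.
  let Y : Option (Fin n) → Ω → ℝ := fun p ω => p.elim (N (.inl η) ω) fun i : Fin n =>
    c i * (N (.inr (η, t (i + 1))) ω - N (.inr (η, t i)) ω)
  have hY : IsGaussianProcess Y P := by
    classical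
    refine IsGaussianProcess.of_isGaussianProcess h.isGaussian_noiseField fun p => ?_
    rcases p with _ | i
    · exact ⟨{.inl η}, ContinuousLinearMap.proj ⟨.inl η, by simp⟩, fun ω => by simp [Y, hN]⟩
    · exact ⟨{.inr (η, t (i + 1)), .inr (η, t i)},
        (c i) • (ContinuousLinearMap.proj ⟨.inr (η, t (i + 1)), by simp⟩ -
          ContinuousLinearMap.proj ⟨.inr (η, t i), by simp⟩), fun ω => by simp [Y, hN]⟩
  have hYmem : ∀ p, MemLp (Y p) 2 P := fun p => (hY.hasGaussianLaw_eval p).memLp_two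
  have hincr : ∀ i, MemLp (fun ω => N (.inr (η, t (i + 1))) ω - N (.inr (η, t i)) ω) 2 P :=
    fun i => (hmem _).sub (hmem _)
  have hcov : ∀ p p', cov[N p, N p'; P] = noiseCov p p' := h.covariance_noiseField
  have hcovY : ∀ p p', cov[Y p, Y p'; P] =
      if p = p' then p.elim q fun i : Fin n => q * (c i ^ 2 * (t (i + 1) - t i : ℝ)) else 0 := by
    have h1 : ∀ i : Fin n, cov[Y none, Y (some i); P] = 0 := by
      intro i
      change cov[N (.inl η),
        fun ω => c i * (N (.inr (η, t (i + 1))) ω - N (.inr (η, t i)) ω); P] = 0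
      rw [covariance_const_mul_right, covariance_fun_sub_right (hmem _) (hmem _) (hmem _),
        hcov, hcov]
      simp [noiseCov]
    have h2 : ∀ i j : Fin n, cov[Y (some i), Y (some j); P] =
        c i * (c j * (q * (min (t (i + 1)) (t (j + 1)) : ℝ≥0) - q * (min (t (i + 1)) (t j) : ℝ≥0)
          - (q * (min (t i) (t (j + 1)) : ℝ≥0) - q * (min (t i) (t j) : ℝ≥0)))) := by
      intro i j
      change cov[fun ω => c i * (N (.inr (η, t (i + 1))) ω - N (.inr (η, t i)) ω),
        fun ω => c j * (N (.inr (η, t (j + 1))) ω - N (.inr (η, t j)) ω); P] = _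
      rw [covariance_const_mul_left, covariance_const_mul_right,
        covariance_fun_sub_left (hmem _) (hmem _) (hincr _),
        covariance_fun_sub_right (hmem _) (hmem _) (hmem _),
        covariance_fun_sub_right (hmem _) (hmem _) (hmem _), hcov, hcov, hcov, hcov]
      simp [noiseCov, ← hq]
    -- For disjoint cells each minimum is an endpoint of the earlier cell, and the four terms
    -- cancel.
    have h3 : ∀ i j : Fin n, i < j → cov[Y (some i), Y (some j); P] = 0 := by
      intro i j hij
      have hij' : (i : ℕ) + 1 ≤ j := hij
      rw [h2, min_eq_left (ht (by omega)), min_eq_left (ht (by omega)),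
        min_eq_left (ht (by omega)), min_eq_left (ht (by omega))]
      ring
    intro p p'
    rcases p with _ | i <;> rcases p' with _ | j
    · change cov[N (.inl η), N (.inl η); P] = _
      rw [hcov]
      simp [noiseCov, hq]
    · simpa using h1 j
    · rw [covariance_comm]
      simpa using h1 i
    · by_cases hij : i = j
      · subst hij
        have : t i ≤ t (i + 1) := ht (by omega)
        rw [h2, min_self, min_self, min_eq_right this, min_eq_left this]
        simp
        ring
      · rw [if_neg (by simpa using hij)]
        rcases lt_or_gt_of_ne hij with hlt | hlt
        · exact h3 i j hlt
        · rw [covariance_comm]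
          exact h3 j i hlt
  have heq : (fun ω => N (.inl η) ω + ∑ i ∈ Finset.range n,
      c i * (N (.inr (η, t (i + 1))) ω - N (.inr (η, t i)) ω)) = fun ω => ∑ p, Y p ω := by
    ext ω
    rw [Fintype.sum_option, Finset.sum_range]
    rfl
  have hlaw : HasGaussianLaw (fun ω => ∑ p, Y p ω) P := hY.hasGaussianLaw_fun_sum
  rw [heq, hlaw.map_eq_gaussianReal]
  congr 2
  · rw [← heq, integral_add ((hmem _).integrable (by norm_num))
      (integrable_finsetSum _ fun i _ => ((hincr i).integrable (by norm_num)).const_mul _),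
      h.integral_noiseField, integral_finsetSum _ fun i _ =>
        ((hincr i).integrable (by norm_num)).const_mul _]
    simp only [zero_add]
    refine Finset.sum_eq_zero fun i _ => ?_
    rw [integral_const_mul, integral_sub ((hmem _).integrable (by norm_num))
      ((hmem _).integrable (by norm_num)), h.integral_noiseField, h.integral_noiseField]
    simp
  · rw [← covariance_self hlaw.aemeasurable, covariance_fun_sum_fun_sum hYmem hYmem]
    simp only [hcovY, Finset.sum_ite_eq, Finset.mem_univ, if_true]
    rw [Fintype.sum_option, Finset.sum_range]
    simp [mul_add, Finset.mul_sum]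

end NoiseField

/-! ### Limits of Gaussian laws and common subsequences. -/

/-- An almost sure limit of centered Gaussian variables with convergent variances is Gaussian. -/
lemma map_eq_gaussianReal_of_tendsto {Ω : Type*} [MeasurableSpace Ω] {P : Measure Ω}
    [IsProbabilityMeasure P] {f : ℕ → Ω → ℝ} {g : Ω → ℝ} {v : ℕ → ℝ} {w : ℝ}
    (hf : ∀ n, AEMeasurable (f n) P) (hv : ∀ n, P.map (f n) = gaussianReal 0 (v n).toNNReal)
    (hfg : ∀ᵐ ω ∂P, Tendsto (fun n => f n ω) atTop (𝓝 (g ω))) (hvw : Tendsto v atTop (𝓝 w)) :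
    P.map g = gaussianReal 0 w.toNNReal := by
  have hg : AEMeasurable g P := aemeasurable_of_tendsto_metrizable_ae atTop hf hfg
  have := Measure.isProbabilityMeasure_map hg
  refine Measure.ext_of_charFun ?_
  ext u
  -- The characteristic functions converge to that of `g` by dominated convergence, and to the
  -- Gaussian one because the latter depends continuously on the variance.
  refine tendsto_nhds_unique (f := fun n => charFun (P.map (f n)) u) (l := atTop) ?_ ?_
  · simp_rw [charFun_apply_real]
    rw [integral_map hg (by fun_prop)]
    simp_rw [integral_map (hf _) (by fun_prop : AEStronglyMeasurable
      (fun x : ℝ => Complex.exp (u * x * Complex.I)) _)]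
    refine tendsto_integral_of_dominated_convergence (fun _ => 1) (fun n => ?_)
      (integrable_const _) (fun n => ?_) ?_
    · exact (by fun_prop : Continuous fun x : ℝ =>
        Complex.exp (u * x * Complex.I)).comp_aestronglyMeasurable (hf n).aestronglyMeasurable
    · refine Eventually.of_forall fun ω => ?_
      rw [← Complex.ofReal_mul, Complex.norm_exp_ofReal_mul_I]
    · filter_upwards [hfg] with ω hω
      exact ((by fun_prop : Continuous fun x : ℝ =>
        Complex.exp (u * x * Complex.I)).tendsto _).comp hω
  · simp_rw [hv, charFun_gaussianReal]
    have h1 : Continuous fun y : ℝ => Complex.exp (u * (0 : ℝ) * Complex.I -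
        ((y.toNNReal : ℝ≥0) : ℝ) * u ^ 2 / 2) := by
      have : Continuous fun y : ℝ => ((y.toNNReal : ℝ≥0) : ℝ) :=
        NNReal.continuous_coe.comp continuous_real_toNNReal
      fun_prop
    simpa [Function.comp_def] using (h1.tendsto w).comp hvw

/-- Finitely many sequences which converge in measure have a common subsequence along which they
converge almost everywhere. -/
lemma exists_seq_tendsto_ae_of_finset {Ω ι E : Type*} [MeasurableSpace Ω] {P : Measure Ω}
    [PseudoEMetricSpace E] {f : ι → ℕ → Ω → E} {g : ι → Ω → E} (s : Finset ι)
    (h : ∀ i ∈ s, TendstoInMeasure P (f i) atTop (g i)) :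
    ∃ ns : ℕ → ℕ, StrictMono ns ∧
      ∀ i ∈ s, ∀ᵐ ω ∂P, Tendsto (fun j => f i (ns j) ω) atTop (𝓝 (g i ω)) := by
  classical
  induction s using Finset.induction_on with
  | empty => exact ⟨id, strictMono_id, by simp⟩
  | insert i s hi ih =>
    obtain ⟨ns, hns, hs⟩ := ih fun j hj => h j (Finset.mem_insert_of_mem hj)
    obtain ⟨ms, hms, hms'⟩ := ((h i (Finset.mem_insert_self i s)).comp
      hns.tendsto_atTop).exists_seq_tendsto_ae
    refine ⟨ns ∘ ms, hns.comp hms, fun j hj => ?_⟩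
    rcases Finset.mem_insert.1 hj with rfl | hj
    · exact hms'
    · filter_upwards [hs j hj] with ω hω
      exact hω.comp hms.tendsto_atTop

/-! ### Uniform grids, Riemann sums and the Euler scheme -/

/-- The `k`-th point of the uniform partition of `[0, T]` into `n` pieces. -/
noncomputable def gridPoint (T : ℝ) (n k : ℕ) : ℝ := k / n * T

section Grid

variable {T : ℝ} {n k : ℕ}

@[simp]
lemma gridPoint_zero : gridPoint T n 0 = 0 := by simp [gridPoint]

lemma gridPoint_self (hn : n ≠ 0) : gridPoint T n n = T := by
  have : (n : ℝ) ≠ 0 := by exact_mod_cast hn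
  simp [gridPoint, this]

lemma gridPoint_succ_sub : gridPoint T n (k + 1) - gridPoint T n k = T / n := by
  simp only [gridPoint]
  push_cast
  ring

lemma gridPoint_le_succ (hT : 0 ≤ T) : gridPoint T n k ≤ gridPoint T n (k + 1) := by
  have : 0 ≤ T / n := by positivity
  linarith [gridPoint_succ_sub (T := T) (n := n) (k := k)]

lemma gridPoint_mem (hT : 0 ≤ T) (hk : k ≤ n) : gridPoint T n k ∈ Icc 0 T := by
  refine ⟨by simp only [gridPoint]; positivity, ?_⟩
  have : (k : ℝ) / n ≤ 1 := div_le_one_of_le₀ (by exact_mod_cast hk) (by positivity)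
  simpa [gridPoint] using mul_le_mul_of_nonneg_right this hT

lemma Icc_gridPoint_subset (hT : 0 ≤ T) (hk : k < n) :
    Icc (gridPoint T n k) (gridPoint T n (k + 1)) ⊆ Icc 0 T :=
  Icc_subset_Icc (gridPoint_mem hT hk.le).1 (gridPoint_mem hT hk).2

lemma IntervalIntegrable.of_gridPoint {E : Type*} [NormedAddCommGroup E] {f : ℝ → E}
    (hf : IntervalIntegrable f volume 0 T) (hT : 0 ≤ T) (hk : k < n) :
    IntervalIntegrable f volume (gridPoint T n k) (gridPoint T n (k + 1)) := by
  refine hf.mono_set ?_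
  rw [uIcc_of_le hT, uIcc_of_le (gridPoint_le_succ hT)]
  exact Icc_gridPoint_subset hT hk

/-- A continuous function oscillates little on the cells of a fine grid. -/
lemma eventually_dist_gridPoint_le {E : Type*} [PseudoMetricSpace E] {f : ℝ → E}
    (hf : ContinuousOn f (Icc 0 T)) (hT : 0 ≤ T) {ε : ℝ} (hε : 0 < ε) :
    ∀ᶠ n : ℕ in atTop, ∀ k < n, ∀ s ∈ Icc (gridPoint T n k) (gridPoint T n (k + 1)),
      ∀ t ∈ Icc (gridPoint T n k) (gridPoint T n (k + 1)), dist (f s) (f t) ≤ ε := by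
  obtain ⟨δ, hδ, h⟩ := Metric.uniformContinuousOn_iff.1
    (isCompact_Icc.uniformContinuousOn_of_continuous hf) ε hε
  have hlim : Tendsto (fun n : ℕ => T / n) atTop (𝓝 0) := tendsto_const_div_atTop_nhds_zero_nat T
  filter_upwards [hlim.eventually_lt_const hδ] with n hn k hk s hs t ht
  refine (h s (Icc_gridPoint_subset hT hk hs) t (Icc_gridPoint_subset hT hk ht) ?_).le
  have := gridPoint_succ_sub (T := T) (n := n) (k := k)
  rw [Real.dist_eq, abs_lt]
  constructor <;> linarith [hs.1, hs.2, ht.1, ht.2]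

/-- Riemann sums, with arbitrary tags, of a continuous function against an integrable density. -/
lemma tendsto_sum_mul_integral {g H : ℝ → ℝ} (hT : 0 ≤ T) (hg : ContinuousOn g (Icc 0 T))
    (hH : IntervalIntegrable H volume 0 T) (τ : ℕ → ℕ → ℝ)
    (hτ : ∀ n, ∀ k < n, τ n k ∈ Icc (gridPoint T n k) (gridPoint T n (k + 1))) :
    Tendsto (fun n => ∑ k ∈ Finset.range n,
      g (τ n k) * ∫ s in (gridPoint T n k)..(gridPoint T n (k + 1)), H s) atTop
      (𝓝 (∫ s in (0 : ℝ)..T, g s * H s)) := by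
  have hgH : IntervalIntegrable (fun s => g s * H s) volume 0 T :=
    hH.continuousOn_mul (by rwa [uIcc_of_le hT])
  have hnorm : IntervalIntegrable (fun s => |H s|) volume 0 T := hH.abs
  set C := ∫ s in (0 : ℝ)..T, |H s| with hC
  have hC0 : 0 ≤ C := intervalIntegral.integral_nonneg hT fun _ _ => abs_nonneg _
  rw [Metric.tendsto_atTop']
  intro ε hε
  -- The `+ 1` covers `C = 0` and makes the final inequality strict.
  have hε' : 0 < ε / (C + 1) := by positivity
  obtain ⟨N, hN⟩ := eventually_atTop.1 (eventually_dist_gridPoint_le hg hT hε')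
  refine ⟨N, fun n hn => ?_⟩
  have hn0 : n ≠ 0 := by omega
  have hsum : ∀ f : ℝ → ℝ, IntervalIntegrable f volume 0 T →
      ∑ k ∈ Finset.range n, ∫ s in (gridPoint T n k)..(gridPoint T n (k + 1)), f s =
        ∫ s in (0 : ℝ)..T, f s := by
    intro f hf
    rw [intervalIntegral.sum_integral_adjacent_intervals (a := gridPoint T n)
      fun k hk => hf.of_gridPoint hT hk]
    simp [gridPoint_self hn0]
  rw [← hsum _ hgH, Real.dist_eq, ← Finset.sum_sub_distrib]
  calc |∑ k ∈ Finset.range n, (g (τ n k) *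
          (∫ s in (gridPoint T n k)..(gridPoint T n (k + 1)), H s) -
          ∫ s in (gridPoint T n k)..(gridPoint T n (k + 1)), g s * H s)|
      ≤ ∑ k ∈ Finset.range n, ε / (C + 1) *
          ∫ s in (gridPoint T n k)..(gridPoint T n (k + 1)), |H s| := by
        refine (Finset.abs_sum_le_sum_abs _ _).trans (Finset.sum_le_sum fun k hk => ?_)
        have hk := Finset.mem_range.1 hk
        have hle := gridPoint_le_succ (n := n) (k := k) hT
        rw [← intervalIntegral.integral_const_mul, ← intervalIntegral.integral_sub
          ((hH.of_gridPoint hT hk).const_mul _) (hgH.of_gridPoint hT hk),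
          ← intervalIntegral.integral_const_mul]
        refine intervalIntegral.norm_integral_le_of_norm_le (E := ℝ) hle ?_
          ((hnorm.of_gridPoint hT hk).const_mul _)
        refine Eventually.of_forall fun s hs => ?_
        rw [← sub_mul, norm_mul]
        refine mul_le_mul_of_nonneg_right ?_ (abs_nonneg _)
        have := hN n hn.le k hk _ (hτ n k hk) s (Ioc_subset_Icc_self hs)
        rwa [Real.dist_eq] at this
    _ = ε / (C + 1) * C := by rw [← Finset.mul_sum, hsum _ hnorm]
    _ < ε := by
        rw [div_mul_eq_mul_div, div_lt_iff₀ (by positivity)]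
        nlinarith

end Grid

/-! ### Measurability with respect to a sub-`σ`-algebra. -/

/-- Measurability, up to a null set, with respect to a smaller `σ`-algebra is preserved by almost
sure limits. -/
lemma aestronglyMeasurable_of_tendsto_ae_of_le {Ω E : Type*} {m mΩ : MeasurableSpace Ω}
    (hm : m ≤ mΩ) {P : Measure Ω} [TopologicalSpace E]
    [TopologicalSpace.IsCompletelyMetrizableSpace E]
    [SecondCountableTopology E] {f : ℕ → Ω → E} {g : Ω → E}
    (hf : ∀ n, AEStronglyMeasurable[m] (f n) P)
    (hfg : ∀ᵐ ω ∂P, Tendsto (fun n => f n ω) atTop (𝓝 (g ω))) : AEStronglyMeasurable[m] g P := by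
  borelize E
  choose f' hf' hff' using hf
  have hlim : ∀ᵐ ω ∂P, Tendsto (fun n => f' n ω) atTop (𝓝 (g ω)) := by
    filter_upwards [hfg, ae_all_iff.2 hff'] with ω h1 h2
    simpa only [h2] using h1
  have hset : MeasurableSet[m] {ω | ∃ c, Tendsto (fun n => f' n ω) atTop (𝓝 c)} :=
    @measurableSet_exists_tendsto ℕ E Ω m _ _ _ _ _ _ _ _ _ fun n => (hf' n).measurable
  -- The set where the `m`-measurable versions converge is itself `m`-measurable, so its full
  -- measure passes to the trimmed measure, and an `m`-measurable limit exists.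
  have htrim : ∀ᵐ ω ∂P.trim hm, ∃ c, Tendsto (fun n => f' n ω) atTop (𝓝 c) := by
    have : P.trim hm {ω | ∃ c, Tendsto (fun n => f' n ω) atTop (𝓝 c)}ᶜ = 0 := by
      rw [trim_measurableSet_eq hm hset.compl]
      exact hlim.mono fun ω h => ⟨_, h⟩
    exact this
  obtain ⟨g', hg', hfg'⟩ := exists_stronglyMeasurable_limit_of_tendsto_ae
    (fun n => (hf' n).aestronglyMeasurable) htrim
  refine ⟨g', hg', ?_⟩
  filter_upwards [hlim, ae_of_ae_trim hm hfg'] with ω h1 h2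
  exact tendsto_nhds_unique h1 h2

/-- Measurability, up to a null set, with respect to a smaller `σ`-algebra is preserved by limits
in measure. -/
lemma aestronglyMeasurable_of_tendstoInMeasure_of_le {Ω E : Type*} {m mΩ : MeasurableSpace Ω}
    (hm : m ≤ mΩ) {P : Measure Ω} [NormedAddCommGroup E] [CompleteSpace E]
    [SecondCountableTopology E] {f : ℕ → Ω → E} {g : Ω → E}
    (hf : ∀ n, AEStronglyMeasurable[m] (f n) P) (hfg : TendstoInMeasure P f atTop g) :
    AEStronglyMeasurable[m] g P := by
  obtain ⟨ns, -, hns⟩ := hfg.exists_seq_tendsto_ae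
  exact aestronglyMeasurable_of_tendsto_ae_of_le hm (fun n => hf (ns n)) hns

/-! ### The Euler scheme with additive noise. -/

/-- The explicit Euler scheme for `x_t = x_0 + ∫₀ᵗ F(s, x_s) ds + N_t`. -/
noncomputable def eulerScheme {E : Type*} [NormedAddCommGroup E] [NormedSpace ℝ E]
    (F : ℝ → E → E) (N : ℝ → E) (x₀ : E) (T : ℝ) (n : ℕ) : ℕ → E
  | 0 => x₀
  | k + 1 => eulerScheme F N x₀ T n k +
      (∫ s in (gridPoint T n k)..(gridPoint T n (k + 1)), F s (eulerScheme F N x₀ T n k)) +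
      (N (gridPoint T n (k + 1)) - N (gridPoint T n k))

/-- Regularity of a drift on `[0, T]`: local Lipschitz continuity in space, uniformly in time, and
integrability in time. -/
structure IsRegularDrift {E : Type*} [NormedAddCommGroup E] [NormedSpace ℝ E] (F : ℝ → E → E)
    (T : ℝ) : Prop where
  lipschitz : ∀ R, ∃ L : ℝ, 0 ≤ L ∧ ∀ t ∈ Icc 0 T, ∀ x y, ‖x‖ ≤ R → ‖y‖ ≤ R →
    ‖F t x - F t y‖ ≤ L * ‖x - y‖
  integrable : ∀ x, IntervalIntegrable (fun t => F t x) volume 0 T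

section Euler

variable {E : Type*} [NormedAddCommGroup E] [NormedSpace ℝ E] {F : ℝ → E → E} {T : ℝ}

/-- The Euler scheme converges to any given continuous solution. -/
lemma tendsto_eulerScheme (hT : 0 ≤ T) (hF : IsRegularDrift F T) {x : ℝ → E}
    (hx : ContinuousOn x (Icc 0 T)) (hint : IntervalIntegrable (fun s => F s (x s)) volume 0 T) :
    Tendsto (fun n => eulerScheme F (fun t => x t - x 0 - ∫ s in (0 : ℝ)..t, F s (x s)) (x 0) T n n)
      atTop (𝓝 (x T)) := by
  obtain ⟨R, hR⟩ := (isCompact_Icc.image_of_continuousOn hx.norm).bddAbove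
  have hR' : ∀ t ∈ Icc 0 T, ‖x t‖ ≤ R := fun t ht => hR ⟨t, ht, rfl⟩
  -- The solution stays in the ball of radius `R`; the scheme will be shown to stay within distance
  -- `1` of it, so one Lipschitz constant serves both.
  obtain ⟨L, hL0, hL⟩ := hF.lipschitz (R + 1)
  rw [Metric.tendsto_atTop']
  intro ε hε
  -- The tolerated oscillation of `x` on a cell. The factor `exp (-(L * T))` offsets the Grönwall
  -- growth; the bound `1` keeps the scheme in the larger ball.
  set w := min (ε / 2) 1 * Real.exp (-(L * T)) with hw
  have hw0 : 0 < w := by positivity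
  obtain ⟨M, hM⟩ := eventually_atTop.1 (eventually_dist_gridPoint_le hx hT hw0)
  refine ⟨M, fun n hn => ?_⟩
  have hn0 : n ≠ 0 := by omega
  have hnpos : (0 : ℝ) < n := by exact_mod_cast Nat.pos_of_ne_zero hn0
  set e := eulerScheme F (fun t => x t - x 0 - ∫ s in (0 : ℝ)..t, F s (x s)) (x 0) T n with he
  set t := gridPoint T n with ht
  set q := L * (T / n) with hq
  have hq0 : 0 ≤ q := by positivity
  have hpow : ∀ k ≤ n, w * ((1 + q) ^ k - 1) ≤ min (ε / 2) 1 := by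
    intro k hk
    have h1 : (1 + q) ^ k ≤ Real.exp (L * T) := by
      calc (1 + q) ^ k ≤ (1 + q) ^ n := pow_le_pow_right₀ (by linarith) hk
        _ ≤ (Real.exp q) ^ n := by
            gcongr
            linarith [Real.add_one_le_exp q]
        _ = Real.exp (L * T) := by
            rw [← Real.exp_nat_mul, hq]
            congr 1
            field_simp
    calc w * ((1 + q) ^ k - 1) ≤ w * Real.exp (L * T) := by
          apply mul_le_mul_of_nonneg_left _ hw0.le
          linarith
      _ = min (ε / 2) 1 := by
          rw [hw, mul_assoc, ← Real.exp_add]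
          simp
  -- Discrete Grönwall inequality: the right side solves `a (k + 1) = (1 + q) * a k + q * w`, `a 0 =
  -- 0`.
  have key : ∀ k ≤ n, ‖e k - x (t k)‖ ≤ w * ((1 + q) ^ k - 1) := by
    intro k
    induction k with
    | zero => simp [he, ht, eulerScheme]
    | succ k ih =>
      intro hk
      have hk' : k < n := hk
      have ih := ih hk'.le
      have hle : t k ≤ t (k + 1) := gridPoint_le_succ hT
      have hsub := Icc_gridPoint_subset hT hk'
      have hek : ‖e k‖ ≤ R + 1 := by
        have h1 : ‖e k - x (t k)‖ ≤ 1 := ih.trans ((hpow k hk'.le).trans (min_le_right _ _))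
        have h2 := hR' (t k) (gridPoint_mem hT hk'.le)
        calc ‖e k‖ = ‖(e k - x (t k)) + x (t k)‖ := by simp
          _ ≤ ‖e k - x (t k)‖ + ‖x (t k)‖ := norm_add_le _ _
          _ ≤ R + 1 := by linarith
      have hi1 : ∀ j ≤ n, IntervalIntegrable (fun s => F s (x s)) volume 0 (t j) := by
        intro j hj
        refine hint.mono_set ?_
        have := gridPoint_mem hT hj
        rw [uIcc_of_le hT, uIcc_of_le this.1]
        exact Icc_subset_Icc le_rfl this.2
      -- The scheme and the solution share the same noise path, whose increments cancel exactly.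
      have hstep : e (k + 1) - x (t (k + 1)) = (e k - x (t k)) +
          ∫ s in (t k)..(t (k + 1)), (F s (e k) - F s (x s)) := by
        rw [intervalIntegral.integral_sub ((hF.integrable _).of_gridPoint hT hk')
          (hint.of_gridPoint hT hk'), ← intervalIntegral.integral_interval_sub_left
          (hi1 (k + 1) hk) (hi1 k hk'.le)]
        simp only [he, eulerScheme]
        abel
      have hbound : ‖∫ s in (t k)..(t (k + 1)), (F s (e k) - F s (x s))‖ ≤
          q * (‖e k - x (t k)‖ + w) := by
        have := intervalIntegral.norm_integral_le_of_norm_le_const (a := t k) (b := t (k + 1))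
          (f := fun s => F s (e k) - F s (x s)) (C := L * (‖e k - x (t k)‖ + w)) ?_
        · rw [gridPoint_succ_sub, abs_of_nonneg (by positivity)] at this
          refine this.trans (le_of_eq ?_)
          rw [hq]
          ring
        · intro s hs
          rw [uIoc_of_le hle] at hs
          have hs := Ioc_subset_Icc_self hs
          refine (hL s (hsub hs) _ _ hek ((hR' s (hsub hs)).trans (by linarith))).trans ?_
          refine mul_le_mul_of_nonneg_left ?_ hL0
          have h2 := hM n hn.le k hk' (t k) ⟨le_rfl, hle⟩ s hs
          rw [dist_eq_norm] at h2
          calc ‖e k - x s‖ = ‖(e k - x (t k)) + (x (t k) - x s)‖ := by simp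
            _ ≤ _ := (norm_add_le _ _).trans (by linarith)
      rw [hstep]
      refine (norm_add_le _ _).trans ((add_le_add_right hbound _).trans ?_)
      have : (1 + q) * ‖e k - x (t k)‖ ≤ (1 + q) * (w * ((1 + q) ^ k - 1)) :=
        mul_le_mul_of_nonneg_left ih (by linarith)
      rw [pow_succ]
      linarith
  have hfin := (key n le_rfl).trans ((hpow n le_rfl).trans (min_le_left _ _))
  rw [ht, gridPoint_self hn0] at hfin
  rw [dist_eq_norm]
  linarith

/-- An Euler step freezes the state but integrates over time, since the drift need only be
integrable in time. Continuity in the state makes each step preserve measurability. -/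
lemma IsRegularDrift.continuous_integral (hT : 0 ≤ T) (hF : IsRegularDrift F T) {n k : ℕ}
    (hk : k < n) :
    Continuous fun x => ∫ s in (gridPoint T n k)..(gridPoint T n (k + 1)), F s x := by
  rw [continuous_iff_continuousAt]
  intro x
  obtain ⟨L, hL0, hL⟩ := hF.lipschitz (‖x‖ + 1)
  refine continuousAt_of_locally_lipschitz (r := 1) one_pos (L * (T / n)) fun y hy => ?_
  have hy' : ‖y‖ ≤ ‖x‖ + 1 := by
    have := norm_le_norm_add_norm_sub' y x
    rw [dist_eq_norm] at hy
    linarith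
  rw [dist_eq_norm, dist_eq_norm, ← intervalIntegral.integral_sub
    ((hF.integrable _).of_gridPoint hT hk) ((hF.integrable _).of_gridPoint hT hk)]
  have := intervalIntegral.norm_integral_le_of_norm_le_const (a := gridPoint T n k)
    (b := gridPoint T n (k + 1)) (f := fun s => F s y - F s x) (C := L * ‖y - x‖) ?_
  · rw [gridPoint_succ_sub, abs_of_nonneg (by positivity)] at this
    linarith
  · intro s hs
    rw [uIoc_of_le (gridPoint_le_succ hT)] at hs
    exact hL s (Icc_gridPoint_subset hT hk (Ioc_subset_Icc_self hs)) _ _ hy' (by linarith)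

/-- The terminal value of a continuous solution of a differential equation with additive noise
is measurable with respect to any `σ`-algebra which contains the initial value and the noise. -/
lemma aestronglyMeasurable_of_additive_noise {Ω : Type*} {m mΩ : MeasurableSpace Ω}
    (hm : m ≤ mΩ) {P : Measure Ω} [CompleteSpace E] [SecondCountableTopology E] (hT : 0 ≤ T)
    (hF : IsRegularDrift F T) {X : ℝ → Ω → E}
    (hcont : ∀ᵐ ω ∂P, ContinuousOn (fun t => X t ω) (Icc 0 T))
    (hint : ∀ᵐ ω ∂P, IntervalIntegrable (fun t => F t (X t ω)) volume 0 T)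
    (h0 : AEStronglyMeasurable[m] (X 0) P)
    (hN : ∀ t ∈ Icc 0 T, AEStronglyMeasurable[m]
      (fun ω => X t ω - X 0 ω - ∫ s in (0 : ℝ)..t, F s (X s ω)) P) :
    AEStronglyMeasurable[m] (X T) P := by
  refine aestronglyMeasurable_of_tendsto_ae_of_le hm (f := fun n ω =>
    eulerScheme F (fun t => X t ω - X 0 ω - ∫ s in (0 : ℝ)..t, F s (X s ω)) (X 0 ω) T n n) ?_ ?_
  · intro n
    suffices h : ∀ k ≤ n, AEStronglyMeasurable[m] (fun ω =>
        eulerScheme F (fun t => X t ω - X 0 ω - ∫ s in (0 : ℝ)..t, F s (X s ω)) (X 0 ω) T n k) P from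
      h n le_rfl
    intro k
    induction k with
    | zero => exact fun _ => h0
    | succ k ih =>
      intro hk
      have ih := ih (Nat.le_of_succ_le hk)
      exact (ih.add ((hF.continuous_integral hT hk).comp_aestronglyMeasurable ih)).add
        ((hN _ (gridPoint_mem hT hk)).sub (hN _ (gridPoint_mem hT (Nat.le_of_succ_le hk))))
  · filter_upwards [hcont, hint] with ω h1 h2
    exact tendsto_eulerScheme hT hF h1 h2

end Euler

/-! ### Linear equations with additive Gaussian noise -/

section Linear

/-- The index `i` lies in the block numbered `i / l`, so a coefficient per block becomes a
coefficient per index. This flattens a coarse sum of fine sums into a single sum. -/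
lemma sum_mul_sum_range_sub (a f : ℕ → ℝ) (m l : ℕ) :
    ∑ k ∈ Finset.range m, a k * (∑ i ∈ Finset.range ((k + 1) * l), f i -
      ∑ i ∈ Finset.range (k * l), f i) = ∑ i ∈ Finset.range (m * l), a (i / l) * f i := by
  induction m with
  | zero => simp
  | succ m ih =>
    have hle : m * l ≤ (m + 1) * l := Nat.mul_le_mul_right _ (Nat.le_succ m)
    rw [Finset.sum_range_succ, ih, ← Finset.sum_range_add_sum_Ico (fun i => a (i / l) * f i) hle,
      ← Finset.sum_Ico_eq_sub _ hle, Finset.mul_sum]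
    congr 1
    refine Finset.sum_congr rfl fun i hi => ?_
    obtain ⟨h1, h2⟩ := Finset.mem_Ico.1 hi
    rw [Nat.div_eq_of_lt_le h1 h2]

variable {T : ℝ} {c : ℝ → ℝ}

/-- The integrating factor `exp(-∫₀ˢ c)`. -/
noncomputable def integratingFactor (c : ℝ → ℝ) (s : ℝ) : ℝ :=
  Real.exp (-∫ u in (0 : ℝ)..s, c u)

@[simp]
lemma integratingFactor_zero : integratingFactor c 0 = 1 := by simp [integratingFactor]

lemma intervalIntegrable_of_continuousOn (hc : ContinuousOn c (Icc 0 T)) {a b : ℝ}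
    (ha : a ∈ Icc 0 T) (hb : b ∈ Icc 0 T) : IntervalIntegrable c volume a b :=
  (hc.mono (uIcc_subset_Icc ha hb)).intervalIntegrable

lemma continuousOn_integratingFactor (hT : 0 ≤ T) (hc : ContinuousOn c (Icc 0 T)) :
    ContinuousOn (integratingFactor c) (Icc 0 T) := by
  have h : ContinuousOn (fun s => ∫ u in (0 : ℝ)..s, c u) (Icc 0 T) := by
    have := intervalIntegral.continuousOn_primitive_interval' (μ := volume) (f := c)
      (b₁ := 0) (b₂ := T) (a := 0) (intervalIntegrable_of_continuousOn hc ⟨le_rfl, hT⟩ ⟨hT, le_rfl⟩)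
      (by simp)
    rwa [uIcc_of_le hT] at this
  exact Real.continuous_exp.comp_continuousOn h.neg

lemma integratingFactor_sub (hT : 0 ≤ T) (hc : ContinuousOn c (Icc 0 T)) {a b : ℝ}
    (ha : 0 ≤ a) (hab : a ≤ b) (hb : b ≤ T) :
    integratingFactor c b - integratingFactor c a =
      -∫ s in a..b, integratingFactor c s * c s := by
  have hsub : Icc a b ⊆ Icc 0 T := Icc_subset_Icc ha hb
  have hφ := continuousOn_integratingFactor hT hc
  have := intervalIntegral.integral_eq_sub_of_hasDerivAt_of_le hab (f := integratingFactor c)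
    (f' := fun s => integratingFactor c s * -c s) (hφ.mono hsub) ?_ ?_
  · rw [← this, ← intervalIntegral.integral_neg]
    simp
  · intro s hs
    have hs' : s ∈ Ioo 0 T := ⟨ha.trans_lt hs.1, hs.2.trans_le hb⟩
    have hnhds : Icc 0 T ∈ 𝓝 s := Icc_mem_nhds hs'.1 hs'.2
    have hI := intervalIntegral.integral_hasDerivAt_right (a := 0) (b := s) (f := c)
      (intervalIntegrable_of_continuousOn hc ⟨le_rfl, hT⟩ (Ioo_subset_Icc_self hs'))
      ((hc.mono Ioo_subset_Icc_self).stronglyMeasurableAtFilter isOpen_Ioo s hs')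
      (hc.continuousAt hnhds)
    exact hI.neg.exp
  · exact ((hφ.mul hc.neg).mono (by rw [uIcc_of_le hab]; exact hsub)).intervalIntegrable

/-- Pathwise solution formula for a linear equation with additive noise, as a limit of Riemann
sums against the noise. -/
lemma tendsto_sum_integratingFactor (hT : 0 ≤ T) (hc : ContinuousOn c (Icc 0 T)) {y : ℝ → ℝ}
    (hy : ContinuousOn y (Icc 0 T)) {N : ℝ → ℝ}
    (hN : ∀ t, N t = y t - y 0 - ∫ s in (0 : ℝ)..t, c s * y s) :
    Tendsto (fun n => y 0 + ∑ k ∈ Finset.range n, integratingFactor c (gridPoint T n k) *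
      (N (gridPoint T n (k + 1)) - N (gridPoint T n k))) atTop
      (𝓝 (integratingFactor c T * y T)) := by
  have hφ := continuousOn_integratingFactor hT hc
  set φ := integratingFactor c with hφdef
  have h0 : (0 : ℝ) ∈ Icc 0 T := ⟨le_rfl, hT⟩
  have hTT : T ∈ Icc 0 T := ⟨hT, le_rfl⟩
  -- Summation by parts: the discrete product rule evaluates `φ` at the left end and `y` at the
  -- right end of each cell. Both error sums are Riemann sums of `∫ φ c y`, so they cancel in the
  -- limit.
  have hlim1 := tendsto_sum_mul_integral hT hφ
    (intervalIntegrable_of_continuousOn (hc.mul hy) h0 hTT) (gridPoint T)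
    (fun n k _ => ⟨le_rfl, gridPoint_le_succ hT⟩)
  have hlim2 := tendsto_sum_mul_integral hT hy
    (intervalIntegrable_of_continuousOn (hφ.mul hc) h0 hTT) (fun n k => gridPoint T n (k + 1))
    (fun n k _ => ⟨gridPoint_le_succ hT, le_rfl⟩)
  have hlim := (hlim2.sub hlim1).const_add (φ T * y T)
  have hzero : (∫ s in (0 : ℝ)..T, y s * (φ s * c s)) -
      ∫ s in (0 : ℝ)..T, φ s * (c s * y s) = 0 := by
    rw [sub_eq_zero]
    congr 1
    ext s
    ring
  simp only [Pi.mul_apply] at hlim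
  rw [hzero, add_zero] at hlim
  refine hlim.congr' ?_
  filter_upwards [eventually_ne_atTop 0] with n hn
  have htel : ∑ k ∈ Finset.range n, (φ (gridPoint T n (k + 1)) * y (gridPoint T n (k + 1)) -
      φ (gridPoint T n k) * y (gridPoint T n k)) = φ T * y T - y 0 := by
    rw [Finset.sum_range_sub (fun k => φ (gridPoint T n k) * y (gridPoint T n k))]
    simp [gridPoint_self hn, hφdef]
  have : φ T * y T = y 0 + ∑ k ∈ Finset.range n, (φ (gridPoint T n (k + 1)) *
      y (gridPoint T n (k + 1)) - φ (gridPoint T n k) * y (gridPoint T n k)) := by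
    rw [htel]
    ring
  rw [this, add_assoc, ← Finset.sum_sub_distrib, ← Finset.sum_add_distrib]
  congr 1
  refine Finset.sum_congr rfl fun k hk => ?_
  have hk := Finset.mem_range.1 hk
  have hk1 := gridPoint_mem (T := T) hT hk
  have hk0 := gridPoint_mem (T := T) hT hk.le
  have h1 := integratingFactor_sub hT hc hk0.1 (gridPoint_le_succ hT) hk1.2
  have h2 : N (gridPoint T n (k + 1)) - N (gridPoint T n k) = y (gridPoint T n (k + 1)) -
      y (gridPoint T n k) - ∫ s in (gridPoint T n k)..(gridPoint T n (k + 1)), c s * y s := by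
    have h3 := intervalIntegral.integral_interval_sub_left
      (intervalIntegrable_of_continuousOn (hc.mul hy) h0 hk1)
      (intervalIntegrable_of_continuousOn (hc.mul hy) h0 hk0)
    simp only [Pi.mul_apply, Nat.succ_eq_add_one] at h3
    rw [hN, hN, ← h3]
    ring
  rw [h2]
  linear_combination (y (gridPoint T n (k + 1))) * h1

end Linear

/-! ### Law of a linear equation, in a fixed direction. -/

section LinearLaw

variable {Ω : Type u} [MeasurableSpace Ω] {P : Measure Ω} {d : ℕ}
  {X₀ : Ω → EuclideanSpace ℝ (Fin d)} {B : Fin d → ℝ≥0 → Ω → ℝ}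

/-- Increment of the noise in the direction `η`, over the `i`-th cell of a uniform partition. -/
noncomputable def noiseIncrement (B : Fin d → ℝ≥0 → Ω → ℝ) (η : EuclideanSpace ℝ (Fin d)) (t : ℝ)
    (n i : ℕ) (ω : Ω) : ℝ :=
  ∑ j, η j * B j (gridPoint t n (i + 1)).toNNReal ω - ∑ j, η j * B j (gridPoint t n i).toNNReal ω

/-- Riemann sums on `[0, t_k]` with `k * l` cells are thereby partial sums on one grid of `[0, T]`,
common to all `k`. -/
lemma gridPoint_gridPoint {T : ℝ} {m k l i : ℕ} (hk : k ≠ 0) :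
    gridPoint (gridPoint T m k) (k * l) i = gridPoint T (m * l) i := by
  simp only [gridPoint]
  rcases eq_or_ne l 0 with rfl | hl
  · simp
  rcases eq_or_ne m 0 with rfl | hm
  · simp
  have h1 : (k : ℝ) ≠ 0 := by exact_mod_cast hk
  have h2 : (l : ℝ) ≠ 0 := by exact_mod_cast hl
  have h3 : (m : ℝ) ≠ 0 := by exact_mod_cast hm
  push_cast
  field_simp

lemma sum_range_tendsto_integral {T : ℝ} (hT : 0 ≤ T) {h : ℝ → ℝ} (hh : ContinuousOn h (Icc 0 T))
    {m k : ℕ} (hk : k ≤ m) :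
    Tendsto (fun l => ∑ i ∈ Finset.range (k * l), h (gridPoint T (m * l) i) ^ 2 *
      (gridPoint T (m * l) (i + 1) - gridPoint T (m * l) i)) atTop
      (𝓝 (∫ s in (0 : ℝ)..(gridPoint T m k), h s ^ 2)) := by
  rcases eq_or_ne k 0 with rfl | hk0
  · simp
  have hmem := gridPoint_mem hT hk
  have hlim := tendsto_sum_mul_integral (T := gridPoint T m k) (g := fun s => h s ^ 2)
    (H := fun _ => 1) hmem.1 ((hh.pow 2).mono (Icc_subset_Icc le_rfl hmem.2))
    intervalIntegrable_const (gridPoint (gridPoint T m k))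
    (fun n j _ => ⟨le_rfl, gridPoint_le_succ hmem.1⟩)
  have hmul : Tendsto (fun l => k * l) atTop atTop :=
    tendsto_id.const_mul_atTop' (Nat.pos_of_ne_zero hk0)
  simpa [Function.comp_def, gridPoint_gridPoint hk0] using hlim.comp hmul

/-- Riemann sum of the Wiener integral of `h` in the direction `η` up to the `k`-th point of the
partition of `[0, T]` into `m` pieces, each of which is divided further into `l` pieces. -/
noncomputable def nestedSum (h : ℝ → ℝ) (B : Fin d → ℝ≥0 → Ω → ℝ) (η : EuclideanSpace ℝ (Fin d))
    (T : ℝ) (m k l : ℕ) (ω : Ω) : ℝ :=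
  ∑ i ∈ Finset.range (k * l), h (gridPoint T (m * l) i) * noiseIncrement B η T (m * l) i ω

lemma IsGaussianNoise.measurable_nestedSum (hX : IsGaussianNoise P X₀ B) (h : ℝ → ℝ)
    (η : EuclideanSpace ℝ (Fin d)) (T : ℝ) (m k l : ℕ) : Measurable (nestedSum h B η T m k l) := by
  refine Finset.measurable_sum _ fun i _ => Measurable.const_mul ?_ _
  exact (hX.measurable_noiseField (.inr (η, _))).sub (hX.measurable_noiseField (.inr (η, _)))

/-- With `a` constant on coarse cells, this is a single sum of fine increments with coefficients `a
(i / l) * h`, so `map_add_sum_increments` applies. -/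
lemma IsGaussianNoise.map_add_sum_nestedSum (hX : IsGaussianNoise P X₀ B)
    (η : EuclideanSpace ℝ (Fin d)) {T : ℝ} (hT : 0 ≤ T) (h : ℝ → ℝ) (a : ℕ → ℝ) (m l : ℕ) :
    P.map (fun ω => ∑ i, η i * X₀ ω i + ∑ k ∈ Finset.range m, a k *
      (nestedSum h B η T m (k + 1) l ω - nestedSum h B η T m k l ω)) = gaussianReal 0
      ((∑ i, η i * η i) * (1 + ∑ k ∈ Finset.range m, a k ^ 2 *
        (∑ i ∈ Finset.range ((k + 1) * l), h (gridPoint T (m * l) i) ^ 2 *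
          (gridPoint T (m * l) (i + 1) - gridPoint T (m * l) i) -
        ∑ i ∈ Finset.range (k * l), h (gridPoint T (m * l) i) ^ 2 *
          (gridPoint T (m * l) (i + 1) - gridPoint T (m * l) i)))).toNNReal := by
  have hmono : Monotone fun i => (gridPoint T (m * l) i).toNNReal :=
    monotone_nat_of_le_succ fun i => Real.toNNReal_le_toNNReal (gridPoint_le_succ hT)
  have hnn : ∀ i, ((gridPoint T (m * l) i).toNNReal : ℝ) = gridPoint T (m * l) i :=
    fun i => Real.coe_toNNReal _ (by simp only [gridPoint]; positivity)
  have hlaw := hX.map_add_sum_increments η (m * l)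
    (fun i => a (i / l) * h (gridPoint T (m * l) i))
    (fun i => (gridPoint T (m * l) i).toNNReal) hmono
  simp only [hnn, mul_pow] at hlaw
  rw [sum_mul_sum_range_sub (fun k => a k ^ 2)]
  simp only [← mul_assoc]
  rw [← hlaw]
  congr 1
  ext ω
  simp only [nestedSum]
  rw [sum_mul_sum_range_sub]
  simp [noiseIncrement, noiseField, mul_assoc]

/-- The first of two limits: the coarse grid is fixed and the fine mesh tends to zero, along a
subsequence on which all the finitely many nested sums converge almost surely. -/
lemma IsGaussianNoise.map_add_sum_of_tendstoInMeasure (hX : IsGaussianNoise P X₀ B)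
    (η : EuclideanSpace ℝ (Fin d)) {T : ℝ} (hT : 0 ≤ T) {h : ℝ → ℝ} (hh : ContinuousOn h (Icc 0 T))
    (a : ℕ → ℝ) (m : ℕ) {N : ℕ → Ω → ℝ}
    (hN : ∀ k ≤ m, TendstoInMeasure P (nestedSum h B η T m k) atTop (N k)) :
    AEMeasurable (fun ω => ∑ i, η i * X₀ ω i +
      ∑ k ∈ Finset.range m, a k * (N (k + 1) ω - N k ω)) P ∧
    P.map (fun ω => ∑ i, η i * X₀ ω i + ∑ k ∈ Finset.range m, a k * (N (k + 1) ω - N k ω)) =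
      gaussianReal 0 ((∑ i, η i * η i) * (1 + ∑ k ∈ Finset.range m, a k ^ 2 *
        ∫ s in (gridPoint T m k)..(gridPoint T m (k + 1)), h s ^ 2)).toNNReal := by
  have hP := hX.isProbabilityMeasure
  obtain ⟨ns, hns, hns'⟩ := exists_seq_tendsto_ae_of_finset (f := nestedSum h B η T m)
    (g := N) (Finset.range (m + 1))
    fun k hk => hN k (Nat.lt_succ_iff.1 (Finset.mem_range.1 hk))
  have hae : ∀ᵐ ω ∂P, Tendsto (fun j => ∑ i, η i * X₀ ω i + ∑ k ∈ Finset.range m, a k *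
      (nestedSum h B η T m (k + 1) (ns j) ω - nestedSum h B η T m k (ns j) ω)) atTop
      (𝓝 (∑ i, η i * X₀ ω i + ∑ k ∈ Finset.range m, a k * (N (k + 1) ω - N k ω))) := by
    filter_upwards [(ae_ball_iff (Finset.range (m + 1)).countable_toSet).2 hns'] with ω hω
    refine (tendsto_finsetSum _ fun k hk => ?_).const_add _
    have hk := Finset.mem_range.1 hk
    exact ((hω (k + 1) (by simpa using hk)).sub (hω k (by simp; omega))).const_mul _
  have hmeas : ∀ l, AEMeasurable (fun ω => ∑ i, η i * X₀ ω i + ∑ k ∈ Finset.range m, a k *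
      (nestedSum h B η T m (k + 1) l ω - nestedSum h B η T m k l ω)) P := fun l =>
    ((hX.measurable_noiseField (.inl η)).add (Finset.measurable_sum _ fun k _ =>
      ((hX.measurable_nestedSum h η T m (k + 1) l).sub
        (hX.measurable_nestedSum h η T m k l)).const_mul _)).aemeasurable
  refine ⟨aemeasurable_of_tendsto_metrizable_ae atTop (fun j => hmeas (ns j)) hae,
    map_eq_gaussianReal_of_tendsto (fun j => hmeas (ns j))
      (fun j => hX.map_add_sum_nestedSum η hT h a m (ns j)) hae ?_⟩
  refine Tendsto.const_mul _ (Tendsto.const_add _ (tendsto_finsetSum _ fun k hk => ?_))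
  have hk := Finset.mem_range.1 hk
  have hsq : ∀ j ≤ m, IntervalIntegrable (fun s => h s ^ 2) volume 0 (gridPoint T m j) :=
    fun j hj => intervalIntegrable_of_continuousOn (hh.pow 2) ⟨le_rfl, hT⟩ (gridPoint_mem hT hj)
  rw [← intervalIntegral.integral_interval_sub_left (hsq (k + 1) hk) (hsq k hk.le)]
  exact (((sum_range_tendsto_integral hT hh hk).comp hns.tendsto_atTop).sub
    ((sum_range_tendsto_integral hT hh hk.le).comp hns.tendsto_atTop)).const_mul _

/-- Law of the solution of a linear equation with additive Gaussian noise, in one direction. -/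
lemma IsGaussianNoise.map_eq_gaussianReal_of_linear (hX : IsGaussianNoise P X₀ B)
    (η : EuclideanSpace ℝ (Fin d)) {T : ℝ} (hT : 0 ≤ T) {c h : ℝ → ℝ}
    (hc : ContinuousOn c (Icc 0 T)) (hh : ContinuousOn h (Icc 0 T)) {y : ℝ → Ω → ℝ}
    (hy0 : ∀ ω, y 0 ω = ∑ i, η i * X₀ ω i)
    (hcont : ∀ᵐ ω ∂P, ContinuousOn (fun t => y t ω) (Icc 0 T))
    (hlim : ∀ t ∈ Icc 0 T, TendstoInMeasure P
      (fun n ω => ∑ i ∈ Finset.range n, h (gridPoint t n i) * noiseIncrement B η t n i ω) atTop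
      (fun ω => y t ω - y 0 ω - ∫ s in (0 : ℝ)..t, c s * y s ω)) :
    P.map (y T) = gaussianReal 0 ((∑ i, η i * η i) * (Real.exp (2 * ∫ s in (0 : ℝ)..T, c s) *
      (1 + ∫ s in (0 : ℝ)..T, integratingFactor c s ^ 2 * h s ^ 2))).toNNReal := by
  have hP := hX.isProbabilityMeasure
  set q : ℝ := ∑ i, η i * η i with hq
  set φ := integratingFactor c with hφ
  have hφc := continuousOn_integratingFactor hT hc
  let N : ℝ → Ω → ℝ := fun t ω => y t ω - y 0 ω - ∫ s in (0 : ℝ)..t, c s * y s ω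
  have hS : ∀ m, ∀ k ≤ m,
      TendstoInMeasure P (nestedSum h B η T m k) atTop (N (gridPoint T m k)) := by
    intro m k hk
    rcases eq_or_ne k 0 with rfl | hk0
    -- For `k = 0` everything vanishes; this case is separate because `0 * l` does not tend to
    -- infinity.
    · refine TendstoInMeasure.congr (f := fun _ _ => 0) (g := fun _ => 0) (fun l => ?_) ?_ ?_
      · exact Eventually.of_forall fun ω => by simp [nestedSum]
      · exact Eventually.of_forall fun ω => by simp [N]
      · intro ε hε
        simp [hε.not_ge]
    have hmul : Tendsto (fun l => k * l) atTop atTop :=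
      tendsto_id.const_mul_atTop' (Nat.pos_of_ne_zero hk0)
    have := (hlim _ (gridPoint_mem hT hk)).comp hmul
    refine this.congr (fun l => Eventually.of_forall fun ω => ?_)
      (Eventually.of_forall fun _ => rfl)
    simp only [Function.comp_apply, noiseIncrement, nestedSum, gridPoint_gridPoint hk0]
  have hstep := fun m => hX.map_add_sum_of_tendstoInMeasure η hT hh
    (fun k => φ (gridPoint T m k)) m (hS m)
  -- The second limit, in the coarse mesh: the summation-by-parts formula gives almost sure
  -- convergence, and the variances are Riemann sums.
  have hfin : P.map (fun ω => φ T * y T ω) = gaussianReal 0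
      (q * (1 + ∫ s in (0 : ℝ)..T, φ s ^ 2 * h s ^ 2)).toNNReal := by
    refine map_eq_gaussianReal_of_tendsto (fun m => (hstep m).1) (fun m => (hstep m).2) ?_ ?_
    · filter_upwards [hcont] with ω hω
      have := tendsto_sum_integratingFactor hT hc hω (N := fun t => N t ω) fun t => rfl
      simpa only [hy0] using this
    · exact ((tendsto_sum_mul_integral hT (hφc.pow 2)
        (intervalIntegrable_of_continuousOn (hh.pow 2) ⟨le_rfl, hT⟩ ⟨hT, le_rfl⟩) (gridPoint T)
        (fun n k _ => ⟨le_rfl, gridPoint_le_succ hT⟩)).const_add _).const_mul _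
  have hφT : φ T ≠ 0 := (Real.exp_pos _).ne'
  have hmeasT : AEMeasurable (fun ω => φ T * y T ω) P := by
    -- `Measure.map` is zero by convention along a function that is not a.e. measurable, so a
    -- Gaussian image law already forces measurability.
    refine AEMeasurable.of_map_ne_zero ?_
    rw [hfin]
    exact IsProbabilityMeasure.ne_zero _
  have hyT : y T = (fun x => (φ T)⁻¹ * x) ∘ fun ω => φ T * y T ω := by
    ext ω
    simp [hφT]
  rw [hyT, ← AEMeasurable.map_map_of_aemeasurable (by fun_prop) hmeasT, hfin,
    gaussianReal_map_const_mul, mul_zero]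
  congr 1
  have hexp : ((φ T)⁻¹) ^ 2 = Real.exp (2 * ∫ s in (0 : ℝ)..T, c s) := by
    rw [hφ, integratingFactor, ← Real.exp_neg, ← Real.exp_nat_mul]
    simp
  rw [← hexp, mul_left_comm, Real.toNNReal_mul (sq_nonneg _)]
  congr 1
  ext
  simp [sq_nonneg]

end LinearLaw

/-! ### Linear images of solutions -/

/-- The linear map between Euclidean spaces given by a matrix. -/
noncomputable def Matrix.euclideanMap {k m : ℕ} (C : Matrix (Fin k) (Fin m) ℝ) :
    EuclideanSpace ℝ (Fin m) →L[ℝ] EuclideanSpace ℝ (Fin k) :=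
  LinearMap.toContinuousLinearMap (Matrix.toLpLin 2 2 C)

lemma Matrix.euclideanMap_apply {k m : ℕ} (C : Matrix (Fin k) (Fin m) ℝ)
    (x : EuclideanSpace ℝ (Fin m)) : C.euclideanMap x = WithLp.toLp 2 (C *ᵥ x.ofLp) := rfl

lemma MeasureTheory.TendstoInMeasure.continuousLinearMap_comp {Ω E F : Type*} [MeasurableSpace Ω]
    {P : Measure Ω} [NormedAddCommGroup E] [NormedSpace ℝ E] [NormedAddCommGroup F]
    [NormedSpace ℝ F] (L : E →L[ℝ] F) {f : ℕ → Ω → E} {g : Ω → E}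
    (h : TendstoInMeasure P f atTop g) :
    TendstoInMeasure P (fun n ω => L (f n ω)) atTop (fun ω => L (g ω)) := by
  rw [tendstoInMeasure_iff_norm] at h ⊢
  intro ε hε
  refine tendsto_of_tendsto_of_tendsto_of_le_of_le tendsto_const_nhds
    -- The `+ 1` keeps the threshold meaningful when `L = 0`.
    (h (ε / (‖L‖ + 1)) (by positivity)) (fun _ => zero_le) fun n => measure_mono fun ω hω => ?_
  simp only [mem_ofPred_eq, ← map_sub] at hω ⊢
  rw [div_le_iff₀ (by positivity)]
  have := L.le_opNorm (f n ω - g ω)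
  nlinarith [norm_nonneg (f n ω - g ω)]

section SDE

variable {Ω : Type u} [MeasurableSpace Ω] {P : Measure Ω} {d k m l : ℕ}

/-- A linear image of a solution which satisfies a closed equation is a solution of it. -/
lemma IsSDESolution.map {B : Fin m → ℝ≥0 → Ω → ℝ}
    {F : ℝ → EuclideanSpace ℝ (Fin k) → EuclideanSpace ℝ (Fin k)} {h : ℝ → ℝ}
    {A : Matrix (Fin k) (Fin m) ℝ} {T : ℝ} {X : ℝ → Ω → EuclideanSpace ℝ (Fin k)}
    (hX : IsSDESolution P B F h A T X) (hT : 0 ≤ T) (C : Matrix (Fin l) (Fin k) ℝ)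
    {F' : ℝ → EuclideanSpace ℝ (Fin l) → EuclideanSpace ℝ (Fin l)}
    (hF' : ∀ t x, C.euclideanMap (F t x) = F' t (C.euclideanMap x)) :
    IsSDESolution P B F' h (C * A) T (fun t ω => C.euclideanMap (X t ω)) where
  isWiener := hX.isWiener
  measurable t ht := C.euclideanMap.continuous.measurable.comp (hX.measurable t ht)
  indep := hX.indep.comp C.euclideanMap.continuous.measurable measurable_id
  continuousOn := by
    filter_upwards [hX.continuousOn] with ω hω
    exact C.euclideanMap.continuous.comp_continuousOn hω
  integrable := by
    filter_upwards [hX.integrable] with ω hω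
    simp_rw [← hF']
    exact ⟨C.euclideanMap.integrable_comp hω.1, C.euclideanMap.integrable_comp hω.2⟩
  integral_eq t ht := by
    refine ((hX.integral_eq t ht).continuousLinearMap_comp C.euclideanMap).congr
      (fun n => Eventually.of_forall fun ω => ?_) ?_
    · simp [Matrix.euclideanMap_apply, Matrix.mulVec_mulVec]
    · filter_upwards [hX.integrable] with ω hω
      have hint : IntervalIntegrable (fun s => F s (X s ω)) volume 0 t := by
        refine hω.mono_set ?_
        rw [uIcc_of_le hT, uIcc_of_le ht.1]
        exact Icc_subset_Icc le_rfl ht.2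
      rw [map_sub, map_sub, ← ContinuousLinearMap.intervalIntegral_comp_comm _ hint]
      simp_rw [hF']

lemma toNNReal_gridPoint (t : ℝ) (n j : ℕ) :
    (gridPoint t n j).toNNReal = j / n * t.toNNReal := by
  rw [gridPoint, Real.toNNReal_mul (by positivity), Real.toNNReal_div (by positivity)]
  simp

lemma sum_mul_wienerSum {Ω : Type u} (h : ℝ → ℝ) (B : Fin d → ℝ≥0 → Ω → ℝ) (t : ℝ)
    (n : ℕ) (ω : Ω) (η : EuclideanSpace ℝ (Fin d)) :
    ∑ i, η i * wienerSum h B t n ω i =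
      ∑ j ∈ Finset.range n, h (gridPoint t n j) * noiseIncrement B η t n j ω := by
  simp only [wienerSum, Finset.mul_sum]
  rw [Finset.sum_comm]
  refine Finset.sum_congr rfl fun j _ => ?_
  rw [noiseIncrement, toNNReal_gridPoint t, toNNReal_gridPoint t, ← Finset.sum_sub_distrib,
    Finset.mul_sum]
  refine Finset.sum_congr rfl fun i _ => ?_
  rw [gridPoint]
  push_cast
  ring

/-! ### The part of the noise that drives a linear image. -/

/-- The members of the noise field in the directions of the rows of a matrix. -/
noncomputable def rowIndex (C : Matrix (Fin k) (Fin d) ℝ) :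
    Fin k ⊕ Fin k × ℝ≥0 → EuclideanSpace ℝ (Fin d) ⊕ EuclideanSpace ℝ (Fin d) × ℝ≥0
  | .inl γ => .inl (WithLp.toLp 2 (C γ))
  | .inr (γ, s) => .inr (WithLp.toLp 2 (C γ), s)

/-- The `σ`-algebra generated by a linear image of the initial value and of the Wiener process. -/
noncomputable abbrev noiseSigmaAlgebra {Ω : Type u} (X₀ : Ω → EuclideanSpace ℝ (Fin d))
    (B : Fin d → ℝ≥0 → Ω → ℝ)
    (C : Matrix (Fin k) (Fin d) ℝ) : MeasurableSpace Ω :=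
  MeasurableSpace.comap (fun ω p => noiseField X₀ B (rowIndex C p) ω) MeasurableSpace.pi

variable {X₀ : Ω → EuclideanSpace ℝ (Fin d)} {B : Fin d → ℝ≥0 → Ω → ℝ}

lemma IsGaussianNoise.noiseSigmaAlgebra_le (hX : IsGaussianNoise P X₀ B)
    (C : Matrix (Fin k) (Fin d) ℝ) : noiseSigmaAlgebra X₀ B C ≤ ‹MeasurableSpace Ω› :=
  Measurable.comap_le (measurable_pi_lambda _ fun p => hX.measurable_noiseField (rowIndex C p))

lemma measurable_noiseField_rowIndex {Ω : Type u} {X₀ : Ω → EuclideanSpace ℝ (Fin d)}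
    {B : Fin d → ℝ≥0 → Ω → ℝ} (C : Matrix (Fin k) (Fin d) ℝ) (p) :
    Measurable[noiseSigmaAlgebra X₀ B C] (noiseField X₀ B (rowIndex C p)) :=
  (measurable_pi_apply p).comp (comap_measurable fun ω p => noiseField X₀ B (rowIndex C p) ω)

/-- Orthogonality of the rows of `C` to those of `D` makes every cross-covariance vanish, which for
a Gaussian field is independence. -/
lemma IsGaussianNoise.indep_noiseSigmaAlgebra (hX : IsGaussianNoise P X₀ B)
    {C : Matrix (Fin k) (Fin d) ℝ} {D : Matrix (Fin l) (Fin d) ℝ} (hCD : C * Dᵀ = 0) :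
    Indep (noiseSigmaAlgebra X₀ B C) (noiseSigmaAlgebra X₀ B D) P := by
  refine hX.indepFun_noiseField (rowIndex C) (rowIndex D) fun p q => ?_
  have h : ∀ i j, ∑ a, C i a * D j a = 0 := fun i j => congr_fun (congr_fun hCD i) j
  rcases p with γ | ⟨γ, s⟩ <;> rcases q with γ' | ⟨γ', t⟩ <;> simp [rowIndex, noiseCov, h]

/-- The terminal value of a solution is a function of the initial value and of the noise. -/
lemma IsSDESolution.aestronglyMeasurable (hX : IsGaussianNoise P X₀ B)
    {C : Matrix (Fin k) (Fin d) ℝ} {F : ℝ → EuclideanSpace ℝ (Fin k) → EuclideanSpace ℝ (Fin k)}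
    {h : ℝ → ℝ} {T : ℝ} {Z : ℝ → Ω → EuclideanSpace ℝ (Fin k)} (hT : 0 ≤ T)
    (hZ : IsSDESolution P B F h C T Z) (hZ0 : ∀ ω, Z 0 ω = C.euclideanMap (X₀ ω))
    (hF : IsRegularDrift F T) :
    AEStronglyMeasurable[noiseSigmaAlgebra X₀ B C] (Z T) P := by
  have hm := hX.noiseSigmaAlgebra_le C
  have hpi : ∀ f : Ω → EuclideanSpace ℝ (Fin k),
      (∀ γ, Measurable[noiseSigmaAlgebra X₀ B C] fun ω => f ω γ) →
      AEStronglyMeasurable[noiseSigmaAlgebra X₀ B C] f P := by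
    intro f hf
    have h1 : Measurable[noiseSigmaAlgebra X₀ B C] fun ω γ => f ω γ :=
      @measurable_pi_lambda _ _ _ (noiseSigmaAlgebra X₀ B C) _ _ hf
    have h2 : Measurable[noiseSigmaAlgebra X₀ B C] f :=
      (WithLp.measurable_toLp 2 (Fin k → ℝ)).comp h1
    exact h2.stronglyMeasurable.aestronglyMeasurable
  refine aestronglyMeasurable_of_additive_noise hm hT hF hZ.continuousOn hZ.integrable
    (hpi _ fun γ => ?_) fun t ht => ?_
  · have := measurable_noiseField_rowIndex (X₀ := X₀) (B := B) C (.inl γ)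
    convert! this using 2 with ω
    rw [hZ0]
    rfl
  -- The noise path at time `t` is a limit in probability of finite linear combinations of
  -- generators of the `σ`-algebra.
  · refine aestronglyMeasurable_of_tendstoInMeasure_of_le hm (fun n => hpi _ fun γ => ?_)
      (hZ.integral_eq t ht)
    have : (fun ω => (WithLp.toLp 2 (C *ᵥ wienerSum h B t n ω) : EuclideanSpace ℝ (Fin k)) γ) =
        fun ω => ∑ j ∈ Finset.range n, h (gridPoint t n j) *
          (noiseField X₀ B (rowIndex C (.inr (γ, (gridPoint t n (j + 1)).toNNReal))) ω -
            noiseField X₀ B (rowIndex C (.inr (γ, (gridPoint t n j).toNNReal))) ω) := by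
      ext ω
      exact sum_mul_wienerSum h B t n ω (WithLp.toLp 2 (C γ))
    rw [this]
    refine Finset.measurable_sum _ fun j _ => Measurable.const_mul ?_ _
    exact (measurable_noiseField_rowIndex C _).sub (measurable_noiseField_rowIndex C _)

/-- Solutions of two equations driven by orthogonal parts of the noise are independent. -/
lemma IsSDESolution.indepFun (hX : IsGaussianNoise P X₀ B) {T : ℝ} (hT : 0 ≤ T)
    {C : Matrix (Fin k) (Fin d) ℝ} {F : ℝ → EuclideanSpace ℝ (Fin k) → EuclideanSpace ℝ (Fin k)}
    {h : ℝ → ℝ} {Z : ℝ → Ω → EuclideanSpace ℝ (Fin k)}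
    (hZ : IsSDESolution P B F h C T Z) (hZ0 : ∀ ω, Z 0 ω = C.euclideanMap (X₀ ω))
    (hF : IsRegularDrift F T)
    {D : Matrix (Fin l) (Fin d) ℝ} {G : ℝ → EuclideanSpace ℝ (Fin l) → EuclideanSpace ℝ (Fin l)}
    {h' : ℝ → ℝ} {Y : ℝ → Ω → EuclideanSpace ℝ (Fin l)}
    (hY : IsSDESolution P B G h' D T Y) (hY0 : ∀ ω, Y 0 ω = D.euclideanMap (X₀ ω))
    (hG : IsRegularDrift G T) (hCD : C * Dᵀ = 0) : IndepFun (Z T) (Y T) P := by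
  obtain ⟨f, hf, hZf⟩ := hZ.aestronglyMeasurable hX hT hZ0 hF
  obtain ⟨g, hg, hYg⟩ := hY.aestronglyMeasurable hX hT hY0 hG
  refine IndepFun.congr ?_ hZf.symm hYg.symm
  exact indep_of_indep_of_le_left (indep_of_indep_of_le_right (hX.indep_noiseSigmaAlgebra hCD)
    hg.measurable.comap_le) hf.measurable.comap_le

/-- The law of the solution of a linear equation with additive noise. -/
lemma IsSDESolution.map_eq_multivariateGaussian (hX : IsGaussianNoise P X₀ B) {T : ℝ} (hT : 0 ≤ T)
    {D : Matrix (Fin l) (Fin d) ℝ} {c h : ℝ → ℝ} {Y : ℝ → Ω → EuclideanSpace ℝ (Fin l)}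
    (hY : IsSDESolution P B (fun t y => c t • y) h D T Y)
    (hY0 : ∀ ω, Y 0 ω = D.euclideanMap (X₀ ω))
    (hc : ContinuousOn c (Icc 0 T)) (hh : ContinuousOn h (Icc 0 T)) {s : ℝ}
    (hs : s = Real.exp (2 * ∫ s in (0 : ℝ)..T, c s) *
      (1 + ∫ s in (0 : ℝ)..T, integratingFactor c s ^ 2 * h s ^ 2)) (hs0 : 0 ≤ s) :
    P.map (Y T) = multivariateGaussian 0 (s • (D * Dᵀ)) := by
  have hP := hX.isProbabilityMeasure
  have hYT := hY.measurable T ⟨hT, le_rfl⟩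
  have hPY := Measure.isProbabilityMeasure_map (μ := P) hYT.aemeasurable
  have hpos : (s • (D * Dᵀ)).PosSemidef := by
    have := Matrix.posSemidef_self_mul_conjTranspose D
    rw [Matrix.conjTranspose_eq_transpose_of_trivial] at this
    exact this.smul hs0
  refine Measure.ext_of_charFun ?_
  ext ξ
  let L : EuclideanSpace ℝ (Fin l) →L[ℝ] ℝ := innerSL ℝ ξ
  have hL : ∀ y, L y = ∑ i, ξ i * y i := fun y => by
    simp [L, PiLp.inner_apply, mul_comm]
  -- Cramér–Wold: the component of `Y` along `ξ` solves a scalar linear equation with noise in the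
  -- direction `Dᵀ ξ`, and `|Dᵀ ξ|² = ξᵀ (D Dᵀ) ξ`.
  set η : EuclideanSpace ℝ (Fin d) := WithLp.toLp 2 (Dᵀ *ᵥ ξ.ofLp) with hη
  have hLD : ∀ v : Fin d → ℝ, L (WithLp.toLp 2 (D *ᵥ v)) = ∑ i, η i * v i := by
    intro v
    rw [hL]
    change ξ.ofLp ⬝ᵥ (D *ᵥ v) = (Dᵀ *ᵥ ξ.ofLp) ⬝ᵥ v
    rw [Matrix.dotProduct_mulVec, Matrix.mulVec_transpose]
  have hlaw := hX.map_eq_gaussianReal_of_linear η hT hc hh (y := fun t ω => L (Y t ω))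
    (fun ω => by rw [hY0, Matrix.euclideanMap_apply, hLD]) ?_ ?_
  · have hLY : AEMeasurable (fun ω => L (Y T ω)) P :=
      (L.continuous.measurable.comp hYT).aemeasurable
    have h1 : charFun (P.map (Y T)) ξ = charFun (P.map fun ω => L (Y T ω)) 1 := by
      rw [charFun_apply, charFun_apply_real, integral_map hYT.aemeasurable (by fun_prop),
        integral_map hLY (by fun_prop)]
      simp [L, real_inner_comm]
    have h2 : ξ.ofLp ⬝ᵥ ((s • (D * Dᵀ)) *ᵥ ξ.ofLp) = (∑ i, η i * η i) * s := by
      change _ = ((Dᵀ *ᵥ ξ.ofLp) ⬝ᵥ (Dᵀ *ᵥ ξ.ofLp)) * s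
      rw [Matrix.smul_mulVec, dotProduct_smul, smul_eq_mul, mul_comm, ← Matrix.mulVec_mulVec,
        Matrix.dotProduct_mulVec, Matrix.mulVec_transpose]
    rw [h1, hlaw, charFun_gaussianReal, charFun_multivariateGaussian hpos, h2, ← hs]
    have h3 : 0 ≤ (∑ i, η i * η i) * s :=
      mul_nonneg (Finset.sum_nonneg fun i _ => mul_self_nonneg _) hs0
    rw [Real.coe_toNNReal _ h3]
    simp
  · filter_upwards [hY.continuousOn] with ω hω
    exact L.continuous.comp_continuousOn hω
  · intro t ht
    refine ((hY.integral_eq t ht).continuousLinearMap_comp L).congr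
      (fun n => Eventually.of_forall fun ω => ?_) ?_
    · simp only
      rw [hLD, sum_mul_wienerSum h B t]
    · filter_upwards [hY.integrable] with ω hω
      have hint : IntervalIntegrable (fun s => c s • Y s ω) volume 0 t := by
        refine hω.mono_set ?_
        rw [uIcc_of_le hT, uIcc_of_le ht.1]
        exact Icc_subset_Icc le_rfl ht.2
      rw [map_sub, map_sub, ← ContinuousLinearMap.intervalIntegral_comp_comm _ hint]
      simp

end SDE

/-! ### Projections, polar decompositions and pseudo-inverses -/

section MatrixAlgebra

variable {d r : ℕ}

/-- Spectral theorem for real symmetric matrices, in matrix form. -/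
lemma Matrix.IsHermitian.exists_orthogonal_diagonal {Q : Matrix (Fin r) (Fin r) ℝ}
    (hQ : Q.IsHermitian) : ∃ O ∈ Matrix.orthogonalGroup (Fin r) ℝ,
      Q = O * Matrix.diagonal hQ.eigenvalues * Oᵀ := by
  refine ⟨hQ.eigenvectorUnitary, hQ.eigenvectorUnitary.2, ?_⟩
  have := hQ.spectral_theorem
  rw [Unitary.conjStarAlgAut_apply] at this
  exact this

/-- Invert the eigenvalues in an orthonormal eigenbasis; the convention `0⁻¹ = 0` is exactly what
the pseudo-inverse requires on the kernel. -/
lemma exists_isMoorePenrose_of_isHermitian {Q : Matrix (Fin r) (Fin r) ℝ} (hQ : Q.IsHermitian) :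
    ∃ N, IsMoorePenrose Q N := by
  obtain ⟨O, hO, hQO⟩ := hQ.exists_orthogonal_diagonal
  have hO1 : Oᵀ * O = 1 := (Matrix.mem_orthogonalGroup_iff' _ _).1 hO
  set v := hQ.eigenvalues
  have key : ∀ u u' : Fin r → ℝ, O * Matrix.diagonal u * Oᵀ * (O * Matrix.diagonal u' * Oᵀ) =
      O * Matrix.diagonal (u * u') * Oᵀ := by
    intro u u'
    have : Matrix.diagonal (u * u') = Matrix.diagonal u * Matrix.diagonal u' := by
      rw [Matrix.diagonal_mul_diagonal]
      rfl
    rw [this]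
    calc _ = O * Matrix.diagonal u * (Oᵀ * O) * Matrix.diagonal u' * Oᵀ := by
          simp only [Matrix.mul_assoc]
      _ = _ := by rw [hO1]; simp only [Matrix.mul_assoc, Matrix.one_mul]
  have hinv : v * v⁻¹ * v = v := by
    ext i
    by_cases h : v i = 0 <;> simp [h]
  have hinv' : v⁻¹ * v * v⁻¹ = v⁻¹ := by
    ext i
    by_cases h : v i = 0 <;> simp [h]
  have hsymm : ∀ u, (O * Matrix.diagonal u * Oᵀ)ᵀ = O * Matrix.diagonal u * Oᵀ := by
    intro u
    simp [Matrix.transpose_mul, Matrix.mul_assoc]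
  refine ⟨O * Matrix.diagonal v⁻¹ * Oᵀ, ?_, ?_, ?_, ?_⟩ <;> rw [hQO] <;> simp only [key, hsymm]
  · rw [hinv]
  · rw [hinv']

/-- Polar decomposition: a tall matrix is an isometry times the square root of its Gram matrix. -/
lemma exists_polar (hrd : r ≤ d) (M : Matrix (Fin d) (Fin r) ℝ) :
    ∃ V : Matrix (Fin r) (Fin d) ℝ, V * Vᵀ = 1 ∧ CFC.sqrt (Mᵀ * M) * V = Mᵀ := by
  have hpos : (Mᵀ * M).PosSemidef := by
    have := Matrix.posSemidef_conjTranspose_mul_self M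
    rwa [Matrix.conjTranspose_eq_transpose_of_trivial] at this
  obtain ⟨O, hO, hQO⟩ := hpos.isHermitian.exists_orthogonal_diagonal
  have hO1 : Oᵀ * O = 1 := (Matrix.mem_orthogonalGroup_iff' _ _).1 hO
  have hO2 : O * Oᵀ = 1 := (Matrix.mem_orthogonalGroup_iff _ _).1 hO
  set v := hpos.isHermitian.eigenvalues with hv
  have hv0 : ∀ i, 0 ≤ v i := hpos.eigenvalues_nonneg
  have hgram : (M * O)ᵀ * (M * O) = Matrix.diagonal v := by
    calc (M * O)ᵀ * (M * O) = Oᵀ * (Mᵀ * M) * O := by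
          simp only [Matrix.transpose_mul, Matrix.mul_assoc]
      _ = (Oᵀ * O) * Matrix.diagonal v * (Oᵀ * O) := by
          rw [hQO]
          simp only [Matrix.mul_assoc]
      _ = _ := by simp [hO1]
  have hentry : ∀ i j, ∑ a, (M * O) a i * (M * O) a j = if i = j then v i else 0 := by
    intro i j
    have := congr_fun (congr_fun hgram i) j
    rwa [Matrix.diagonal_apply] at this
  -- The columns of `M * O` are orthogonal with squared norms `v i`. Those with `v i > 0`,
  -- normalized, extend to an orthonormal basis indexed by `Fin d`; its first `r` members are the
  -- rows of `E`.
  let u : Fin d → EuclideanSpace ℝ (Fin d) := fun i =>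
    if h : (i : ℕ) < r then WithLp.toLp 2 ((√(v ⟨i, h⟩))⁻¹ • (M * O).col ⟨i, h⟩) else 0
  let s : Set (Fin d) := {i | ∃ h : (i : ℕ) < r, 0 < v ⟨i, h⟩}
  have hu : Orthonormal ℝ (s.domRestrict u) := by
    rw [orthonormal_iff_ite]
    rintro ⟨i, hi, hvi⟩ ⟨j, hj, hvj⟩
    have h1 : inner ℝ (u i) (u j) = (√(v ⟨i, hi⟩))⁻¹ * (√(v ⟨j, hj⟩))⁻¹ *
        ∑ a, (M * O) a ⟨i, hi⟩ * (M * O) a ⟨j, hj⟩ := by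
      simp only [u, hi, hj, dif_pos, PiLp.inner_apply, Finset.mul_sum]
      refine Finset.sum_congr rfl fun a _ => ?_
      simp only [Pi.smul_apply, Matrix.col_apply, smul_eq_mul, RCLike.inner_apply, conj_trivial]
      ring
    simp only [Set.domRestrict_apply, h1, hentry]
    by_cases hij : i = j
    · subst hij
      simp only [if_true, ← mul_inv, Real.mul_self_sqrt hvi.le]
      exact inv_mul_cancel₀ hvi.ne'
    · have : (⟨i, hi⟩ : Fin r) ≠ ⟨j, hj⟩ := fun h => hij (Fin.ext (Fin.mk.inj_iff.1 h))
      simp [this, hij]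
  obtain ⟨b, hb⟩ := hu.exists_orthonormalBasis_extension_of_card_eq (by simp)
  let E : Matrix (Fin r) (Fin d) ℝ := Matrix.of fun i a => b (Fin.castLE hrd i) a
  have hEE : E * Eᵀ = 1 := by
    ext i j
    have := orthonormal_iff_ite.1 b.orthonormal (Fin.castLE hrd i) (Fin.castLE hrd j)
    rw [PiLp.inner_apply] at this
    simp only [Matrix.mul_apply, Matrix.transpose_apply, Matrix.one_apply, E, Matrix.of_apply]
    simpa [mul_comm] using this
  set D : Matrix (Fin r) (Fin r) ℝ := Matrix.diagonal fun i => √(v i) with hD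
  have hMO : M * O = Eᵀ * D := by
    ext a i
    rw [hD, Matrix.mul_diagonal]
    simp only [Matrix.transpose_apply, E, Matrix.of_apply]
    -- For a zero eigenvalue the column of `M * O` vanishes, so the arbitrary basis vector chosen
    -- there is harmless.
    rcases (hv0 i).eq_or_lt with h0 | hpos
    · have h2 := hentry i i
      rw [if_pos rfl, ← h0, Finset.sum_eq_zero_iff_of_nonneg fun a _ => mul_self_nonneg _] at h2
      simpa [← h0] using h2 a (Finset.mem_univ a)
    · have h3 := hb (Fin.castLE hrd i) ⟨i.2, hpos⟩
      rw [h3]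
      have : √(v i) ≠ 0 := (Real.sqrt_pos.2 hpos).ne'
      simp only [u, Fin.val_castLE, Fin.is_lt, dif_pos, Fin.eta, Pi.smul_apply, Matrix.col_apply,
        smul_eq_mul]
      field_simp
  have hDpos : D.PosSemidef := Matrix.PosSemidef.diagonal fun i => Real.sqrt_nonneg _
  have hsqrt : CFC.sqrt (Mᵀ * M) = O * D * Oᵀ := by
    refine CFC.sqrt_unique ?_ ?_
    · calc O * D * Oᵀ * (O * D * Oᵀ) = O * D * (Oᵀ * O) * D * Oᵀ := by
            simp only [Matrix.mul_assoc]
        _ = O * (D * D) * Oᵀ := by rw [hO1]; simp only [Matrix.mul_assoc, Matrix.one_mul]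
        _ = Mᵀ * M := by
            rw [hQO, hD, Matrix.diagonal_mul_diagonal]
            simp only [Real.mul_self_sqrt (hv0 _)]
    · have := hDpos.mul_mul_conjTranspose_same O
      rw [Matrix.conjTranspose_eq_transpose_of_trivial] at this
      exact this.nonneg
  refine ⟨O * E, ?_, ?_⟩
  · calc O * E * (O * E)ᵀ = O * (E * Eᵀ) * Oᵀ := by
          simp only [Matrix.transpose_mul, Matrix.mul_assoc]
      _ = 1 := by rw [hEE, Matrix.mul_one, hO2]
  · calc CFC.sqrt (Mᵀ * M) * (O * E) = O * D * (Oᵀ * O) * E := by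
          rw [hsqrt]
          simp only [Matrix.mul_assoc]
      _ = O * (M * O)ᵀ := by
          rw [hO1, hMO, Matrix.transpose_mul, Matrix.transpose_transpose, hD,
            Matrix.diagonal_transpose]
          simp only [Matrix.mul_assoc, Matrix.one_mul]
      _ = Mᵀ := by rw [Matrix.transpose_mul, ← Matrix.mul_assoc, hO2, Matrix.one_mul]

lemma exists_mul_transpose_eq_of_le {k : ℕ} (hk : k ≤ r) (A : Matrix (Fin d) (Fin k) ℝ) :
    ∃ U : Matrix (Fin d) (Fin r) ℝ, U * Uᵀ = A * Aᵀ := by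
  obtain ⟨c, rfl⟩ := Nat.exists_eq_add_of_le hk
  refine ⟨Matrix.of fun i => Fin.append (A i) 0, ?_⟩
  ext i j
  simp [Matrix.mul_apply, Fin.sum_univ_add]

/-! ### The weight space: projections, frames and overlaps. -/

namespace Params

variable (θ : Params d r)

lemma toEuclideanCLM_proj :
    Matrix.toEuclideanCLM (n := Fin d) (𝕜 := ℝ) θ.proj = θ.weightSpace.starProjection := by
  simp [proj]

lemma proj_mul_self : θ.proj * θ.proj = θ.proj := by
  apply EquivLike.injective (Matrix.toEuclideanCLM (n := Fin d) (𝕜 := ℝ))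
  rw [map_mul, toEuclideanCLM_proj]
  exact θ.weightSpace.isIdempotentElem_starProjection

lemma transpose_proj : θ.projᵀ = θ.proj := by
  rw [← Matrix.conjTranspose_eq_transpose_of_trivial, ← Matrix.star_eq_conjTranspose]
  apply EquivLike.injective (Matrix.toEuclideanCLM (n := Fin d) (𝕜 := ℝ))
  rw [map_star, toEuclideanCLM_proj]
  exact isSelfAdjoint_starProjection θ.weightSpace

lemma projPerp_eq : θ.projPerp = 1 - θ.proj := by
  apply EquivLike.injective (Matrix.toEuclideanCLM (n := Fin d) (𝕜 := ℝ))
  rw [map_sub, map_one, toEuclideanCLM_proj, projPerp, StarAlgEquiv.apply_symm_apply,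
    Submodule.starProjection_orthogonal']

lemma transpose_projPerp : θ.projPerpᵀ = θ.projPerp := by
  rw [projPerp_eq, Matrix.transpose_sub, Matrix.transpose_one, transpose_proj]

lemma projPerp_mul_self : θ.projPerp * θ.projPerp = θ.projPerp := by
  rw [projPerp_eq, Matrix.sub_mul, Matrix.mul_sub, Matrix.mul_sub, proj_mul_self]
  simp

lemma proj_mul_w : θ.proj * θ.w = θ.w := by
  ext i γ
  have hmem : WithLp.toLp 2 (θ.w.col γ) ∈ θ.weightSpace := Submodule.subset_span ⟨γ, rfl⟩
  have := θ.weightSpace.starProjection_eq_self_iff.2 hmem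
  rw [← toEuclideanCLM_proj, Matrix.toEuclideanCLM_toLp] at this
  exact congr_fun (congr_arg WithLp.ofLp this) i

lemma projPerp_mul_w : θ.projPerp * θ.w = 0 := by
  rw [projPerp_eq, Matrix.sub_mul, proj_mul_w, Matrix.one_mul, sub_self]

/-- A matrix which fixes the columns of `w` fixes their span. -/
lemma mul_proj_eq_of_mul_w_eq {K : Matrix (Fin d) (Fin d) ℝ} (hK : K * θ.w = θ.w) :
    K * θ.proj = θ.proj := by
  have hspan : ∀ x ∈ θ.weightSpace, Matrix.toEuclideanCLM (n := Fin d) (𝕜 := ℝ) K x = x := by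
    intro x hx
    induction hx using Submodule.span_induction with
    | mem x hx =>
      obtain ⟨γ, rfl⟩ := hx
      rw [Matrix.toEuclideanCLM_toLp]
      congr 1
      ext i
      exact congr_fun (congr_fun hK i) γ
    | zero => simp
    | add x y _ _ hx hy => rw [map_add, hx, hy]
    | smul a x _ hx => rw [map_smul, hx]
  apply EquivLike.injective (Matrix.toEuclideanCLM (n := Fin d) (𝕜 := ℝ))
  rw [map_mul, toEuclideanCLM_proj]
  ext1 x
  exact hspan _ (Submodule.starProjection_apply_mem _ x)

/-- An orthonormal basis of the column space has at most `r` members; zero columns pad it to width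
`r` without changing `U * Uᵀ`. -/
lemma exists_frame : ∃ U : Matrix (Fin d) (Fin r) ℝ, U * Uᵀ = θ.proj := by
  set b := stdOrthonormalBasis ℝ θ.weightSpace with hb
  have hk : Module.finrank ℝ θ.weightSpace ≤ r := by
    have := finrank_range_le_card (R := ℝ)
      (fun γ : Fin r => (WithLp.toLp 2 (θ.w.col γ) : EuclideanSpace ℝ (Fin d)))
    rw [Fintype.card_fin] at this
    exact this
  obtain ⟨U, hU⟩ := exists_mul_transpose_eq_of_le hk
    (Matrix.of fun i a => (b a : EuclideanSpace ℝ (Fin d)) i)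
  refine ⟨U, hU.trans ?_⟩
  apply EquivLike.injective (Matrix.toEuclideanCLM (n := Fin d) (𝕜 := ℝ))
  rw [toEuclideanCLM_proj, b.starProjection_eq_sum_rankOne]
  ext x i
  simp only [Matrix.ofLp_toEuclideanCLM, Matrix.mulVec, dotProduct, Matrix.mul_apply,
    Matrix.transpose_apply, Matrix.of_apply, sum_apply,
    InnerProductSpace.rankOne_apply, WithLp.ofLp_sum, Finset.sum_apply, WithLp.ofLp_smul,
    Pi.smul_apply, smul_eq_mul, PiLp.inner_apply, RCLike.inner_apply, conj_trivial, Finset.sum_mul]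
  rw [Finset.sum_comm]
  exact Finset.sum_congr rfl fun a _ => Finset.sum_congr rfl fun j _ => by ring

/-- The rescaled weights `w / √d`. -/
noncomputable def scaledW : Matrix (Fin d) (Fin r) ℝ := (1 / √(d : ℝ)) • θ.w

lemma overlap_eq : θ.overlap = θ.scaledWᵀ * θ.scaledW := by
  rw [overlap, scaledW, Matrix.transpose_smul, Matrix.smul_mul, Matrix.mul_smul, smul_smul]
  congr 1
  rw [div_mul_div_comm, Real.mul_self_sqrt (Nat.cast_nonneg d), one_mul]

lemma posSemidef_overlap : θ.overlap.PosSemidef := by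
  rw [overlap_eq, ← Matrix.conjTranspose_eq_transpose_of_trivial]
  exact Matrix.posSemidef_conjTranspose_mul_self _

lemma w_eq_smul_scaledW : θ.w = √(d : ℝ) • θ.scaledW := by
  rcases Nat.eq_zero_or_pos d with rfl | hd
  · ext i
    exact i.elim0
  · have : √(d : ℝ) ≠ 0 := (Real.sqrt_pos.2 (by exact_mod_cast hd)).ne'
    rw [scaledW, smul_smul, mul_one_div_cancel this, one_smul]

lemma scaledW_transpose_mul_projPerp : θ.scaledWᵀ * θ.projPerp = 0 := by
  have := congr_arg Matrix.transpose θ.projPerp_mul_w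
  rw [Matrix.transpose_mul, transpose_projPerp, Matrix.transpose_zero] at this
  rw [scaledW, Matrix.transpose_smul, Matrix.smul_mul, this, smul_zero]

/-- The projection onto the column space in terms of the pseudo-inverse of the overlap. -/
lemma scaledW_mul_moorePenrose {N : Matrix (Fin r) (Fin r) ℝ} (hN : IsMoorePenrose θ.overlap N) :
    θ.scaledW * N * θ.scaledWᵀ = θ.proj := by
  set M := θ.scaledW with hM
  have hfix : M * N * Mᵀ * M = M := by
    -- The difference `E` has the form `M * A` and satisfies `Mᵀ * E = 0`, so `Eᵀ * E = 0` and `E =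
    -- 0`.
    have h1 : Mᵀ * (M * N * Mᵀ * M - M) = 0 := by
      have h2 := hN.mul_mul_self
      rw [overlap_eq] at h2
      rw [Matrix.mul_sub, ← h2]
      simp only [Matrix.mul_assoc, sub_eq_zero, hM]
    have h3 : (M * N * Mᵀ * M - M)ᵀ * (M * N * Mᵀ * M - M) = 0 := by
      have h4 : M * N * Mᵀ * M - M = M * (N * Mᵀ * M - 1) := by
        rw [Matrix.mul_sub, Matrix.mul_one]
        simp only [Matrix.mul_assoc]
      conv_lhs => rw [h4, Matrix.transpose_mul, Matrix.mul_assoc, ← h4, h1]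
      rw [Matrix.mul_zero]
    rw [← Matrix.conjTranspose_eq_transpose_of_trivial, Matrix.conjTranspose_mul_self_eq_zero] at h3
    exact sub_eq_zero.1 h3
  have hw : M * N * Mᵀ * θ.w = θ.w := by
    rw [w_eq_smul_scaledW, Matrix.mul_smul, hfix]
  -- `M N Mᵀ` fixes the column space and vanishes on its orthogonal complement, so it is the
  -- projection.
  have h5 := θ.mul_proj_eq_of_mul_w_eq hw
  have h6 : M * N * Mᵀ * θ.projPerp = 0 := by
    rw [Matrix.mul_assoc, θ.scaledW_transpose_mul_projPerp, Matrix.mul_zero]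
  rw [projPerp_eq, Matrix.mul_sub, h5, Matrix.mul_one, sub_eq_zero] at h6
  exact h6

variable {θ}

/-- With `A = Π⊥ U`, one has `A Aᵀ = Π⊥ Π Π⊥ = 0`, hence `A = 0`. Orthonormality of the columns of
`U` is not needed. -/
lemma proj_mul_frame {U : Matrix (Fin d) (Fin r) ℝ} (hU : U * Uᵀ = θ.proj) : θ.proj * U = U := by
  have h1 : (θ.projPerp * U) * (θ.projPerp * U)ᵀ = 0 := by
    rw [Matrix.transpose_mul, Matrix.mul_assoc, ← Matrix.mul_assoc U, hU, transpose_projPerp,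
      projPerp_eq, Matrix.mul_sub, proj_mul_self]
    simp
  rw [← Matrix.conjTranspose_eq_transpose_of_trivial, Matrix.self_mul_conjTranspose_eq_zero,
    projPerp_eq, Matrix.sub_mul, Matrix.one_mul, sub_eq_zero] at h1
  exact h1.symm

/-- The coordinates in the frame `U` are a linear function of the overlaps `wᵀ x / √d`. -/
lemma frame_transpose_eq {U : Matrix (Fin d) (Fin r) ℝ} (hU : U * Uᵀ = θ.proj)
    {N : Matrix (Fin r) (Fin r) ℝ} (hN : IsMoorePenrose θ.overlap N) :
    ((1 / √(d : ℝ)) • (θ.wᵀ * U))ᵀ * N * θ.scaledWᵀ = Uᵀ := by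
  have h1 : ((1 / √(d : ℝ)) • (θ.wᵀ * U))ᵀ = Uᵀ * θ.scaledW := by
    rw [Matrix.transpose_smul, Matrix.transpose_mul, Matrix.transpose_transpose, scaledW,
      Matrix.mul_smul]
  have h2 := congr_arg Matrix.transpose (proj_mul_frame hU)
  rw [Matrix.transpose_mul, transpose_proj] at h2
  rw [h1, Matrix.mul_assoc, Matrix.mul_assoc, ← Matrix.mul_assoc θ.scaledW,
    θ.scaledW_mul_moorePenrose hN, h2]

/-- Write `s Π⊥ = s - s U Uᵀ`. Passing from `-s U Uᵀ` to the `r × r` matrix `-s Uᵀ U` splits off `X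
^ (d - r)` from the characteristic polynomial; the shift by `s` turns this into `(X - s) ^ (d - r)`.
-/
lemma le_rootMultiplicity_charpoly (hrd : r ≤ d) {U : Matrix (Fin d) (Fin r) ℝ}
    (hU : U * Uᵀ = θ.proj) (s : ℝ) :
    d ≤ (s • θ.projPerp).charpoly.rootMultiplicity s + r := by
  have h1 : s • θ.projPerp = ((-s) • U) * Uᵀ - Matrix.scalar (Fin d) (-s) := by
    rw [Matrix.smul_mul, hU, projPerp_eq, Matrix.scalar_apply, ← Matrix.smul_one_eq_diagonal]
    module
  have h2 := Matrix.charpoly_mul_comm_of_le ((-s) • U) Uᵀ (by simpa using hrd)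
  have h3 : (Polynomial.X - Polynomial.C s) ^ (d - r) ∣ (s • θ.projPerp).charpoly := by
    rw [h1, Matrix.charpoly_sub_scalar, h2]
    simp only [Fintype.card_fin, Polynomial.mul_comp, Polynomial.pow_comp, Polynomial.X_comp]
    refine Dvd.dvd.mul_right ?_ _
    simp [sub_eq_add_neg]
  have h4 := (Polynomial.le_rootMultiplicity_iff (Matrix.charpoly_monic _).ne_zero).2 h3
  omega

end Params

end MatrixAlgebra

/-! ### Coefficients of the generative equation -/

section Generated

variable {d r k : ℕ}

lemma stdGaussian_map_euclideanMap (C : Matrix (Fin k) (Fin d) ℝ) :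
    (stdGaussian (EuclideanSpace ℝ (Fin d))).map C.euclideanMap =
      multivariateGaussian 0 (C * Cᵀ) := by
  have hpos : (C * Cᵀ).PosSemidef := by
    have := Matrix.posSemidef_self_mul_conjTranspose C
    rwa [Matrix.conjTranspose_eq_transpose_of_trivial] at this
  have hm := C.euclideanMap.continuous.measurable
  have := Measure.isProbabilityMeasure_map (μ := stdGaussian (EuclideanSpace ℝ (Fin d)))
    hm.aemeasurable
  refine Measure.ext_of_charFun ?_
  ext ξ
  have h1 : ∀ x, inner ℝ (C.euclideanMap x) ξ =
      inner ℝ x (WithLp.toLp 2 (Cᵀ *ᵥ ξ.ofLp) : EuclideanSpace ℝ (Fin d)) := by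
    intro x
    rw [real_inner_comm, real_inner_comm _ x]
    simp only [EuclideanSpace.inner_eq_star_dotProduct, star_trivial, Matrix.euclideanMap_apply]
    rw [dotProduct_comm, Matrix.dotProduct_mulVec, ← Matrix.mulVec_transpose, dotProduct_comm]
  have h2 : ξ.ofLp ⬝ᵥ ((C * Cᵀ) *ᵥ ξ.ofLp) =
      ‖(WithLp.toLp 2 (Cᵀ *ᵥ ξ.ofLp) : EuclideanSpace ℝ (Fin d))‖ ^ 2 := by
    rw [← real_inner_self_eq_norm_sq, EuclideanSpace.inner_eq_star_dotProduct, star_trivial,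
      ← Matrix.mulVec_mulVec, Matrix.dotProduct_mulVec, Matrix.mulVec_transpose]
  rw [charFun_multivariateGaussian hpos, h2, charFun_apply, integral_map hm.aemeasurable
    (by fun_prop)]
  simp_rw [h1]
  rw [← charFun_apply, charFun_stdGaussian]
  simp [neg_div]

lemma multivariateGaussian_eq_map_add (m : EuclideanSpace ℝ (Fin k))
    (C : Matrix (Fin k) (Fin k) ℝ) :
    multivariateGaussian m C = (multivariateGaussian 0 C).map (m + ·) := by
  rw [multivariateGaussian, multivariateGaussian, Measure.map_map (by fun_prop) (by fun_prop)]
  congr 1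
  ext1 x
  simp

lemma wienerSum_mulVec {Ω : Type u} (h : ℝ → ℝ) (V : Matrix (Fin r) (Fin d) ℝ)
    (B : Fin d → ℝ≥0 → Ω → ℝ) (t : ℝ) (n : ℕ) (ω : Ω) :
    wienerSum h (fun γ s ω => (V *ᵥ fun i => B i s ω) γ) t n ω = V *ᵥ wienerSum h B t n ω := by
  ext γ
  simp only [wienerSum, Matrix.mulVec, dotProduct, Finset.mul_sum, ← Finset.sum_sub_distrib]
  rw [Finset.sum_comm]
  exact Finset.sum_congr rfl fun i _ => Finset.sum_congr rfl fun j _ => by ring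

namespace ModelSpec

variable (S : ModelSpec)

lemma Icc_T_subset : Icc 0 S.T ⊆ Icc (0 : ℝ) 1 := Icc_subset_Icc le_rfl S.T_mem.2

lemma continuousOn_derivWithin {f : ℝ → ℝ} (hf : ContDiffOn ℝ 2 f (Icc 0 1)) :
    ContinuousOn (derivWithin f (Icc 0 1)) (Icc 0 S.T) :=
  (hf.continuousOn_derivWithin (uniqueDiffOn_Icc zero_lt_one) (by norm_num)).mono S.Icc_T_subset

lemma continuousOn_Gam : ContinuousOn S.Gam (Icc 0 S.T) := by
  have hα := S.contDiffOn_α.continuousOn.mono S.Icc_T_subset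
  have hβ := S.contDiffOn_β.continuousOn.mono S.Icc_T_subset
  have hε := S.continuousOn_ε.mono S.Icc_T_subset
  refine ((S.continuousOn_derivWithin S.contDiffOn_β).sub
    (((S.continuousOn_derivWithin S.contDiffOn_α).div hα S.α_ne_zero).mul hβ)).add
    (hε.mul (hβ.div (hα.pow 2) fun t ht => pow_ne_zero 2 (S.α_ne_zero t ht)))

lemma continuousOn_Del (b : ℝ) : ContinuousOn (S.Del b) (Icc 0 S.T) := by
  have hα := S.contDiffOn_α.continuousOn.mono S.Icc_T_subset
  have hε := S.continuousOn_ε.mono S.Icc_T_subset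
  exact ((continuousOn_const.mul S.continuousOn_Gam).add
    ((S.continuousOn_derivWithin S.contDiffOn_α).div hα S.α_ne_zero)).sub
    (hε.div (hα.pow 2) fun t ht => pow_ne_zero 2 (S.α_ne_zero t ht))

lemma continuousOn_diffusion : ContinuousOn (fun t => √(2 * S.ε t)) (Icc 0 S.T) :=
  (continuousOn_const.mul (S.continuousOn_ε.mono S.Icc_T_subset)).sqrt

lemma variance_eq (b : ℝ) :
    S.variance b S.T = Real.exp (2 * ∫ s in (0 : ℝ)..S.T, S.Del b s) *
      (1 + ∫ s in (0 : ℝ)..S.T, integratingFactor (S.Del b) s ^ 2 * √(2 * S.ε s) ^ 2) := by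
  rw [variance]
  congr 2
  rw [← intervalIntegral.integral_const_mul]
  refine intervalIntegral.integral_congr fun s hs => ?_
  rw [uIcc_of_le S.T_mem.1] at hs
  have hε := S.ε_nonneg s (S.Icc_T_subset hs)
  simp only [integratingFactor]
  rw [Real.sq_sqrt (by positivity), ← Real.exp_nat_mul]
  push_cast
  ring_nf

lemma variance_nonneg (b : ℝ) : 0 ≤ S.variance b S.T := by
  have : 0 ≤ ∫ s in (0 : ℝ)..S.T, integratingFactor (S.Del b) s ^ 2 * √(2 * S.ε s) ^ 2 :=
    intervalIntegral.integral_nonneg S.T_mem.1 fun s _ => by positivity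
  rw [variance_eq]
  positivity

/-- Drift of the low-dimensional equation for the overlaps `wᵀ x / √d`. -/
noncomputable def reducedDrift (θ : Params d r) (t : ℝ) (z : EuclideanSpace ℝ (Fin r)) :
    EuclideanSpace ℝ (Fin r) :=
  S.Del θ.b t • z + S.Gam t •
    WithLp.toLp 2 (θ.overlap *ᵥ fun γ => S.σ (z γ + S.p t * θ.v γ))

/-- The structural fact behind the splitting: the nonlinearity reads `x` through `Mᵀ x` and enters
through `C M`. The choice `C = Mᵀ` closes the equation with `C M = Q`; the choice `C = Π⊥` gives `C
M = 0`. -/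
lemma euclideanMap_drift (θ : Params d r) (C : Matrix (Fin k) (Fin d) ℝ) (t : ℝ)
    (x : EuclideanSpace ℝ (Fin d)) :
    C.euclideanMap (S.drift θ t x) = S.Del θ.b t • C.euclideanMap x + S.Gam t •
      WithLp.toLp 2 ((C * θ.scaledW) *ᵥ
        fun γ => S.σ (θ.scaledWᵀ.euclideanMap x γ + S.p t * θ.v γ)) := by
  have h1 : (fun γ => S.σ (θ.scaledWᵀ.euclideanMap x γ + S.p t * θ.v γ)) =
      fun γ => S.σ ((θ.wᵀ *ᵥ x.ofLp) γ / √(d : ℝ) + S.p t * θ.v γ) := by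
    ext γ
    simp only [Matrix.euclideanMap_apply, Params.scaledW, Matrix.transpose_smul,
      Matrix.smul_mulVec, Pi.smul_apply, smul_eq_mul]
    rw [one_div_mul_eq_div]
  have h2 : ∀ y : Fin r → ℝ, C.euclideanMap (WithLp.toLp 2 ((1 / √(d : ℝ)) • (θ.w *ᵥ y))) =
      WithLp.toLp 2 ((C * θ.scaledW) *ᵥ y) := by
    intro y
    rw [Matrix.euclideanMap_apply, Params.scaledW, Matrix.mul_smul, Matrix.smul_mulVec,
      Matrix.mulVec_smul, Matrix.mulVec_mulVec]
  rw [h1, drift, dae, map_add, map_smul, map_smul, map_add, map_smul, h2, Del]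
  module

lemma euclideanMap_scaledW_drift (θ : Params d r) (t : ℝ) (x : EuclideanSpace ℝ (Fin d)) :
    θ.scaledWᵀ.euclideanMap (S.drift θ t x) =
      S.reducedDrift θ t (θ.scaledWᵀ.euclideanMap x) := by
  rw [euclideanMap_drift, ← Params.overlap_eq, reducedDrift]

lemma euclideanMap_projPerp_drift (θ : Params d r) (t : ℝ) (x : EuclideanSpace ℝ (Fin d)) :
    θ.projPerp.euclideanMap (S.drift θ t x) = S.Del θ.b t • θ.projPerp.euclideanMap x := by
  rw [euclideanMap_drift, Params.scaledW, Matrix.mul_smul, Params.projPerp_mul_w]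
  simp

lemma isRegularDrift_linear (b : ℝ) :
    IsRegularDrift (fun t (y : EuclideanSpace ℝ (Fin k)) => S.Del b t • y) S.T where
  lipschitz R := by
    obtain ⟨K, hK⟩ := isCompact_Icc.exists_bound_of_continuousOn (S.continuousOn_Del b)
    refine ⟨|K|, abs_nonneg K, fun t ht x y _ _ => ?_⟩
    rw [← smul_sub, norm_smul]
    gcongr
    exact (hK t ht).trans (le_abs_self K)
  integrable x := by
    refine ContinuousOn.intervalIntegrable ?_
    rw [uIcc_of_le S.T_mem.1]
    exact (S.continuousOn_Del b).smul continuousOn_const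

/-- The activations of the hidden layer, as a function of overlaps and time encoding. -/
noncomputable def hidden (θ : Params d r) (z : EuclideanSpace ℝ (Fin r)) (y : ℝ) :
    EuclideanSpace ℝ (Fin r) :=
  WithLp.toLp 2 fun γ => S.σ (z γ + y * θ.v γ)

/-- Boundedness of `p` keeps the arguments of `σ` in a fixed compact interval, on which a locally
Lipschitz function is Lipschitz; hence the uniformity in time. -/
lemma exists_lipschitz_hidden (θ : Params d r) (R : ℝ) :
    ∃ L : ℝ, 0 ≤ L ∧ ∀ t ∈ Icc 0 S.T, ∀ x y : EuclideanSpace ℝ (Fin r), ‖x‖ ≤ R → ‖y‖ ≤ R →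
      ‖S.hidden θ x (S.p t) - S.hidden θ y (S.p t)‖ ≤ L * ‖x - y‖ := by
  obtain ⟨C, hC⟩ := S.bounded_p
  obtain ⟨L, hL⟩ := LocallyLipschitzOn.exists_lipschitzOnWith_of_compact
    (isCompact_Icc (a := -(R + C * ‖θ.v‖)) (b := R + C * ‖θ.v‖))
    S.locallyLipschitz_σ.locallyLipschitzOn
  refine ⟨L, L.2, fun t ht x y hx hy => ?_⟩
  have hmem : ∀ x : EuclideanSpace ℝ (Fin r), ‖x‖ ≤ R → ∀ γ,
      x γ + S.p t * θ.v γ ∈ Icc (-(R + C * ‖θ.v‖)) (R + C * ‖θ.v‖) := by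
    intro x hx γ
    rw [mem_Icc, ← abs_le]
    have h1 : |x γ| ≤ R := (PiLp.norm_apply_le x γ).trans hx
    have h2 : |S.p t| * |θ.v γ| ≤ C * ‖θ.v‖ := mul_le_mul (hC t (S.Icc_T_subset ht))
      (norm_le_pi_norm θ.v γ) (abs_nonneg _) ((abs_nonneg _).trans (hC t (S.Icc_T_subset ht)))
    exact (abs_add_le _ _).trans (add_le_add h1 ((abs_mul _ _).trans_le h2))
  refine le_of_sq_le_sq ?_ (by positivity)
  rw [mul_pow, EuclideanSpace.real_norm_sq_eq, EuclideanSpace.real_norm_sq_eq, Finset.mul_sum]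
  refine Finset.sum_le_sum fun γ _ => ?_
  rw [← mul_pow, ← sq_abs, ← sq_abs (_ * _), abs_mul, abs_of_nonneg (NNReal.coe_nonneg L)]
  have := hL.dist_le_mul _ (hmem x hx γ) _ (hmem y hy γ)
  rw [Real.dist_eq, Real.dist_eq, add_sub_add_right_eq_sub] at this
  exact pow_le_pow_left₀ (abs_nonneg _) this 2

/-- The time encoding is only measurable, so integrability comes from its boundedness and the
continuity of `σ`. -/
lemma intervalIntegrable_hidden (θ : Params d r) (z : EuclideanSpace ℝ (Fin r)) :
    IntervalIntegrable (fun t => S.hidden θ z (S.p t)) volume 0 S.T := by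
  have hσ := S.locallyLipschitz_σ.continuous
  have hcont : Continuous (S.hidden θ z) := by
    unfold hidden
    fun_prop
  obtain ⟨C, hC⟩ := S.bounded_p
  obtain ⟨K, hK⟩ := (isCompact_Icc (a := -C) (b := C)).exists_bound_of_continuousOn
    hcont.continuousOn
  rw [intervalIntegrable_iff_integrableOn_Icc_of_le S.T_mem.1]
  refine Integrable.of_bound (C := K)
    (hcont.measurable.comp S.measurable_p).aestronglyMeasurable ?_
  filter_upwards [ae_restrict_mem measurableSet_Icc] with t ht
  exact hK _ (abs_le.1 (hC t (S.Icc_T_subset ht)))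

lemma isRegularDrift_reducedDrift (θ : Params d r) : IsRegularDrift (S.reducedDrift θ) S.T := by
  have heq : ∀ t z, S.reducedDrift θ t z =
      S.Del θ.b t • z + S.Gam t • θ.overlap.euclideanMap (S.hidden θ z (S.p t)) := fun _ _ => rfl
  constructor
  · intro R
    obtain ⟨L₁, hL₁, h₁⟩ := (S.isRegularDrift_linear (k := r) θ.b).lipschitz R
    obtain ⟨L₂, hL₂, h₂⟩ := S.exists_lipschitz_hidden θ R
    obtain ⟨K, hK⟩ := isCompact_Icc.exists_bound_of_continuousOn S.continuousOn_Gam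
    refine ⟨L₁ + |K| * (‖θ.overlap.euclideanMap‖ * L₂), by positivity, fun t ht x y hx hy => ?_⟩
    rw [heq, heq, add_sub_add_comm, ← smul_sub (S.Gam t), ← map_sub, add_mul]
    refine (norm_add_le _ _).trans (add_le_add (h₁ t ht x y hx hy) ?_)
    rw [norm_smul, mul_assoc, mul_assoc]
    refine mul_le_mul ((hK t ht).trans (le_abs_self K)) ?_ (norm_nonneg _) (abs_nonneg _)
    exact (ContinuousLinearMap.le_opNorm _ _).trans (by gcongr; exact h₂ t ht x y hx hy)
  · intro z
    simp_rw [heq]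
    refine ((S.isRegularDrift_linear (k := r) θ.b).integrable z).add ?_
    have h := S.intervalIntegrable_hidden θ z
    refine IntervalIntegrable.continuousOn_smul
      ⟨θ.overlap.euclideanMap.integrable_comp h.1, θ.overlap.euclideanMap.integrable_comp h.2⟩ ?_
    rw [uIcc_of_le S.T_mem.1]
    exact S.continuousOn_Gam

end ModelSpec

/-! ### The generated law -/

variable {Ω : Type u} [MeasurableSpace Ω] {P : Measure Ω} {S : ModelSpec} {θ : Params d r}
  {B : Fin d → ℝ≥0 → Ω → ℝ} {X : ℝ → Ω → EuclideanSpace ℝ (Fin d)}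

lemma IsSDESolution.isGaussianNoise {F : ℝ → EuclideanSpace ℝ (Fin d) → EuclideanSpace ℝ (Fin d)}
    {h : ℝ → ℝ} {A : Matrix (Fin d) (Fin d) ℝ} {T : ℝ} (hX : IsSDESolution P B F h A T X)
    (hT : 0 ≤ T) (hX0 : P.map (X 0) = stdGaussian (EuclideanSpace ℝ (Fin d))) :
    IsGaussianNoise P (X 0) B where
  measurable := hX.measurable 0 ⟨le_rfl, hT⟩
  map_eq := hX0
  isWiener := hX.isWiener
  indep := hX.indep

/-- The overlaps `wᵀ X / √d` solve the low-dimensional equation. -/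
lemma IsSDESolution.overlaps
    (hX : IsSDESolution P B (S.drift θ) (fun t => √(2 * S.ε t)) 1 S.T X) :
    IsSDESolution P B (S.reducedDrift θ) (fun t => √(2 * S.ε t)) θ.scaledWᵀ S.T
      (fun t ω => θ.scaledWᵀ.euclideanMap (X t ω)) := by
  have := hX.map S.T_mem.1 θ.scaledWᵀ (S.euclideanMap_scaledW_drift θ)
  rwa [Matrix.mul_one] at this

/-- The part of the process orthogonal to the weights solves a linear equation. -/
lemma IsSDESolution.orthogonalPart
    (hX : IsSDESolution P B (S.drift θ) (fun t => √(2 * S.ε t)) 1 S.T X) :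
    IsSDESolution P B (fun t y => S.Del θ.b t • y) (fun t => √(2 * S.ε t)) θ.projPerp S.T
      (fun t ω => θ.projPerp.euclideanMap (X t ω)) := by
  have := hX.map S.T_mem.1 θ.projPerp (S.euclideanMap_projPerp_drift θ)
  rwa [Matrix.mul_one] at this

lemma IsSDESolution.indepFun_overlaps_orthogonalPart
    (hX : IsSDESolution P B (S.drift θ) (fun t => √(2 * S.ε t)) 1 S.T X)
    (hX0 : P.map (X 0) = stdGaussian (EuclideanSpace ℝ (Fin d))) :
    IndepFun (fun ω => θ.scaledWᵀ.euclideanMap (X S.T ω))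
      (fun ω => θ.projPerp.euclideanMap (X S.T ω)) P := by
  refine IsSDESolution.indepFun (hX.isGaussianNoise S.T_mem.1 hX0) S.T_mem.1 hX.overlaps
    (fun _ => rfl) (S.isRegularDrift_reducedDrift θ) hX.orthogonalPart (fun _ => rfl)
    (S.isRegularDrift_linear θ.b) ?_
  rw [Params.transpose_projPerp, Params.scaledW_transpose_mul_projPerp]

lemma IsSDESolution.map_orthogonalPart
    (hX : IsSDESolution P B (S.drift θ) (fun t => √(2 * S.ε t)) 1 S.T X)
    (hX0 : P.map (X 0) = stdGaussian (EuclideanSpace ℝ (Fin d))) :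
    P.map (fun ω => θ.projPerp.euclideanMap (X S.T ω)) =
      multivariateGaussian 0 (S.variance θ.b S.T • θ.projPerp) := by
  have := IsSDESolution.map_eq_multivariateGaussian (hX.isGaussianNoise S.T_mem.1 hX0) S.T_mem.1
    hX.orthogonalPart (fun _ => rfl) (S.continuousOn_Del θ.b) S.continuousOn_diffusion
    (S.variance_eq θ.b) (S.variance_nonneg θ.b)
  rwa [Params.transpose_projPerp, Params.projPerp_mul_self] at this

/-- The process and the probability space are kept; only the driver changes, to `V B` with `Q^{1/2}
V = Mᵀ`. -/
lemma IsSDESolution.isReducedLaw (hrd : r ≤ d) [IsProbabilityMeasure P]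
    (hX : IsSDESolution P B (S.drift θ) (fun t => √(2 * S.ε t)) 1 S.T X)
    (hX0 : P.map (X 0) = stdGaussian (EuclideanSpace ℝ (Fin d))) :
    IsReducedLaw.{u} S θ (P.map fun ω => θ.scaledWᵀ.euclideanMap (X S.T ω)) := by
  have hnoise := hX.isGaussianNoise S.T_mem.1 hX0
  have hZ := hX.overlaps
  obtain ⟨V, hV, hVW⟩ := exists_polar hrd θ.scaledW
  rw [← Params.overlap_eq] at hVW
  refine ⟨Ω, inferInstance, P, inferInstance, fun γ s ω => (V *ᵥ fun i => B i s ω) γ,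
    fun t ω => θ.scaledWᵀ.euclideanMap (X t ω), ?_,
    ⟨hnoise.isWiener_mulVec V hV, hZ.measurable, ?_, hZ.continuousOn, hZ.integrable, ?_⟩, rfl⟩
  · have := Measure.map_map (μ := P) θ.scaledWᵀ.euclideanMap.continuous.measurable
      hnoise.measurable
    rw [hX0, stdGaussian_map_euclideanMap, Matrix.transpose_transpose, ← Params.overlap_eq] at this
    exact this.symm
  · refine hZ.indep.comp (φ := id) (ψ := fun b γ s => (V *ᵥ fun i => b i s) γ) measurable_id ?_
    refine measurable_pi_lambda _ fun γ => measurable_pi_lambda _ fun s => ?_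
    simp only [Matrix.mulVec, dotProduct]
    fun_prop
  · intro t ht
    have := hZ.integral_eq t ht
    simp_rw [wienerSum_mulVec, Matrix.mulVec_mulVec, hVW]
    exact this

/-- Fubini for the product law of `(C, Y)`: given `C = c`, the sum is the law of `Y` translated by
`f c`. -/
lemma map_add_apply_of_indepFun [IsProbabilityMeasure P] {E F : Type*} [MeasurableSpace E]
    [NormedAddCommGroup F] [MeasurableSpace F] [BorelSpace F] [SecondCountableTopology F]
    {C : Ω → E} {Y : Ω → F} {f : E → F} (hC : Measurable C) (hY : Measurable Y)
    (hf : Measurable f) (hCY : IndepFun C Y P) {A : Set F} (hA : MeasurableSet A) :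
    P.map (fun ω => f (C ω) + Y ω) A = ∫⁻ c, (P.map Y).map (f c + ·) A ∂P.map C := by
  have hm : Measurable fun p : E × F => f p.1 + p.2 := by fun_prop
  have h1 : P.map (fun ω => f (C ω) + Y ω) =
      ((P.map C).prod (P.map Y)).map fun p : E × F => f p.1 + p.2 := by
    rw [← (indepFun_iff_map_prod_eq_prod_map_map hC.aemeasurable hY.aemeasurable).1 hCY,
      Measure.map_map hm (by fun_prop)]
    rfl
  have := Measure.isProbabilityMeasure_map (μ := P) hY.aemeasurable
  rw [h1, Measure.map_apply hm hA, Measure.prod_apply (hm hA)]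
  refine lintegral_congr fun c => ?_
  rw [Measure.map_apply (by fun_prop) hA]
  rfl

lemma Params.posSemidef_projPerp (θ : Params d r) : θ.projPerp.PosSemidef := by
  have := Matrix.posSemidef_self_mul_conjTranspose θ.projPerp
  rwa [Matrix.conjTranspose_eq_transpose_of_trivial, θ.transpose_projPerp, θ.projPerp_mul_self]
    at this

/-- The generated law is a Gaussian mixture over its projection onto the weight space. -/
lemma IsSDESolution.isGaussianMixture [IsProbabilityMeasure P]
    (hX : IsSDESolution P B (S.drift θ) (fun t => √(2 * S.ε t)) 1 S.T X)
    (hX0 : P.map (X 0) = stdGaussian (EuclideanSpace ℝ (Fin d)))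
    {U : Matrix (Fin d) (Fin r) ℝ} (hU : U * Uᵀ = θ.proj) :
    IsGaussianMixture (P.map (X S.T))
      ((P.map (X S.T)).map Uᵀ.euclideanMap) U.euclideanMap
      (fun _ => S.variance θ.b S.T • θ.projPerp) := by
  have hXT := hX.measurable S.T ⟨S.T_mem.1, le_rfl⟩
  have hUm := Uᵀ.euclideanMap.continuous.measurable
  have hYm := θ.projPerp.euclideanMap.continuous.measurable.comp hXT
  have hpos := θ.posSemidef_projPerp.smul (S.variance_nonneg θ.b)
  have hmap : (P.map (X S.T)).map Uᵀ.euclideanMap =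
      P.map fun ω => Uᵀ.euclideanMap (X S.T ω) := Measure.map_map hUm hXT
  obtain ⟨O, hO, hOD⟩ := hpos.isHermitian.exists_orthogonal_diagonal
  obtain ⟨N, hN⟩ := exists_isMoorePenrose_of_isHermitian θ.posSemidef_overlap.isHermitian
  rw [hmap]
  refine ⟨Measure.isProbabilityMeasure_map (hUm.comp hXT).aemeasurable,
    U.euclideanMap.continuous.measurable, fun _ _ => measurable_const, fun _ => hpos,
    ⟨O, hO, fun _ => ?_⟩, fun A hA => ?_⟩
  · have hO1 : Oᵀ * O = 1 := (Matrix.mem_orthogonalGroup_iff' _ _).1 hO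
    rw [hOD]
    have : Oᵀ * (O * Matrix.diagonal hpos.isHermitian.eigenvalues * Oᵀ) * O =
        (Oᵀ * O) * Matrix.diagonal hpos.isHermitian.eigenvalues * (Oᵀ * O) := by
      simp only [Matrix.mul_assoc]
    rw [this, hO1, Matrix.one_mul, Matrix.mul_one]
    exact Matrix.isDiag_diagonal _
  -- `Uᵀ X_T` is a linear image of the overlaps, through `Uᵀ = Gᵀ Q⁺ Mᵀ`, and inherits their
  -- independence from the orthogonal part.
  · have hindep : IndepFun (fun ω => Uᵀ.euclideanMap (X S.T ω))
        (fun ω => θ.projPerp.euclideanMap (X S.T ω)) P := by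
      have := (hX.indepFun_overlaps_orthogonalPart hX0).comp
        (((1 / √(d : ℝ)) • (θ.wᵀ * U))ᵀ * N).euclideanMap.continuous.measurable measurable_id
      convert! this using 1
      ext1 ω
      simp only [Function.comp_apply, Matrix.euclideanMap_apply, Matrix.mulVec_mulVec,
        Params.frame_transpose_eq hU hN]
    have hdecomp : X S.T = fun ω => U.euclideanMap (Uᵀ.euclideanMap (X S.T ω)) +
        θ.projPerp.euclideanMap (X S.T ω) := by
      ext1 ω
      simp only [Matrix.euclideanMap_apply, Matrix.mulVec_mulVec, hU, ← WithLp.toLp_add,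
        ← Matrix.add_mulVec, Params.projPerp_eq, add_sub_cancel, Matrix.one_mulVec]
    conv_lhs => rw [hdecomp]
    refine (map_add_apply_of_indepFun (hUm.comp hXT) hYm U.euclideanMap.continuous.measurable
      hindep hA).trans (lintegral_congr fun c => ?_)
    rw [multivariateGaussian_eq_map_add, ← hX.map_orthogonalPart hX0]
    rfl

lemma finrank_span_range_euclideanMap_le (U : Matrix (Fin d) (Fin r) ℝ) :
    Module.finrank ℝ (Submodule.span ℝ (range U.euclideanMap)) ≤ r := by
  have h1 : Submodule.span ℝ (range U.euclideanMap) = U.euclideanMap.toLinearMap.range := by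
    rw [← ContinuousLinearMap.coe_coe, ← LinearMap.coe_range, Submodule.span_eq]
  rw [h1]
  simpa using LinearMap.finrank_range_le U.euclideanMap.toLinearMap

end Generated

/-! ### Assembly for one generation. -/

/-- At each generation, for every realization of the training data, the generated density is again
a Gaussian mixture with `κ = r` and `μ(c) = c`, where `ℝʳ` is identified with the weight column
space `𝒲` by a matrix `U` with `U Uᵀ = Π_𝒲` (if `w` has rank `r`, the columns of `U` are an
orthonormal basis of `𝒲`). -/
theorem mainTheorem3 {d r κ : ℕ} (hrd : r ≤ d) {Ω : Type*} [MeasurableSpace Ω] (P : Measure Ω)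
    [IsProbabilityMeasure P]
    -- the original target density
    (ρ₀ : Measure (EuclideanSpace ℝ (Fin d))) (π₀ : Measure (EuclideanSpace ℝ (Fin κ)))
    (μ₀ : EuclideanSpace ℝ (Fin κ) → EuclideanSpace ℝ (Fin d))
    (cov₀ : EuclideanSpace ℝ (Fin κ) → Matrix (Fin d) (Fin d) ℝ)
    (htarget : IsGaussianMixture ρ₀ π₀ μ₀ cov₀)
    -- the successive generations
    (S : ℕ → ModelSpec) (θ₀ : ℕ → Params d r) (n : ℕ → ℕ)
    (z : ℕ → ℕ → Ω → EuclideanSpace ℝ (Fin d) × EuclideanSpace ℝ (Fin d))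
    (θ : ℕ → Ω → Params d r) (ρ : ℕ → Ω → Measure (EuclideanSpace ℝ (Fin d)))
    (hρ₀ : ∀ ω, ρ 0 ω = ρ₀) (hchain : IsRetrainingChain.{u} P S θ₀ n z θ ρ) (g : ℕ) (ω : Ω) :
    (∃ U : Matrix (Fin d) (Fin r) ℝ, U * Uᵀ = (θ g ω).proj) ∧
    ∀ U : Matrix (Fin d) (Fin r) ℝ, U * Uᵀ = (θ g ω).proj →
      -- the generated density is a mixture of the form of the target
      IsGaussianMixture (ρ (g + 1) ω)
        ((ρ (g + 1) ω).map fun x => WithLp.toLp 2 (Uᵀ *ᵥ x.ofLp))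
        (fun c : EuclideanSpace ℝ (Fin r) => WithLp.toLp 2 (U *ᵥ c.ofLp))
        (fun _ => (S g).variance (θ g ω).b (S g).T • (θ g ω).projPerp) ∧
      -- the centroids span a space of dimension at most `r`
      Module.finrank ℝ (Submodule.span ℝ
        (range fun c : EuclideanSpace ℝ (Fin r) => WithLp.toLp 2 (U *ᵥ c.ofLp))) ≤ r ∧
      -- all but at most `r` eigenvalues of the common covariance equal the scalar variance
      d ≤ ((S g).variance (θ g ω).b (S g).T • (θ g ω).projPerp).charpoly.rootMultiplicity
        ((S g).variance (θ g ω).b (S g).T) + r ∧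
      -- the mixing law is the law of `Gᵀ Q⁺ Z_T`, with `G = wᵀ U / √d` and `Q = wᵀ w / d`
      ∃ (ν : Measure (EuclideanSpace ℝ (Fin r))) (Qinv : Matrix (Fin r) (Fin r) ℝ),
        IsReducedLaw.{u} (S g) (θ g ω) ν ∧ IsMoorePenrose (θ g ω).overlap Qinv ∧
        (ρ (g + 1) ω).map (fun x => WithLp.toLp 2 (Uᵀ *ᵥ x.ofLp)) =
          ν.map fun y => WithLp.toLp 2
            ((((1 / √(d : ℝ)) • ((θ g ω).wᵀ * U))ᵀ * Qinv) *ᵥ y.ofLp) := by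
  obtain ⟨Ω', _, P', _, B, X, hX0, hX, hρ⟩ := hchain.generated g ω
  refine ⟨(θ g ω).exists_frame, fun U hU => ?_⟩
  obtain ⟨N, hN⟩ := exists_isMoorePenrose_of_isHermitian (θ g ω).posSemidef_overlap.isHermitian
  rw [hρ]
  refine ⟨hX.isGaussianMixture hX0 hU, finrank_span_range_euclideanMap_le U,
    Params.le_rootMultiplicity_charpoly hrd hU _, _, N, hX.isReducedLaw hrd hX0, hN, ?_⟩
  -- Both laws are images of the same variable `X_T`, so their equality reduces to the pointwise
  -- identity `Uᵀ = Gᵀ Q⁺ Mᵀ`.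
  have hXT := hX.measurable (S g).T ⟨(S g).T_mem.1, le_rfl⟩
  have h1 := Measure.map_map (μ := P') Uᵀ.euclideanMap.continuous.measurable hXT
  have h2 := Measure.map_map (μ := P')
    (((1 / √(d : ℝ)) • ((θ g ω).wᵀ * U))ᵀ * N).euclideanMap.continuous.measurable
    ((θ g ω).scaledWᵀ.euclideanMap.continuous.measurable.comp hXT)
  refine h1.trans (Eq.trans ?_ h2.symm)
  congr 1
  ext1 ω'
  simp only [Function.comp_apply, Matrix.euclideanMap_apply, Matrix.mulVec_mulVec,
    Params.frame_transpose_eq hU hN]
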